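/- For a bi-infinite sequence $a=(a_n)_{n\in\mathbb{Z}}$ of positive integers put $$\lambda_0(a)=[a_0;a_1,a_2,\dots]+[0;a_{-1},a_{-2},\dots],$$ where $[c_0;c_1,c_2,\dots]=c_0+\cfrac{1}{c_1+\cfrac{1}{c_2+\cdots}}$. In a displayed bi-infinite word, an asterisk marks the letter $a_0$ at position $0$, and $\overline{\gamma}$ denotes the infinite repetition of the finite word $\gamma$ (to the left at the left end, to the right at the right end, and in both directions if the word consists of $\overline{\gamma}$ only). Let $$L=\Big\{\limsup_{|p|,|q|\to\infty,\ p,q\in\mathbb{Z}}\frac{1}{|q(q\alpha-p)|}<\infty:\ \alpha\in\mathbb{R}\setminus\mathbb{Q}\Big\}$$ be the Lagrange spectrum and $$M=\Big\{\frac{1}{\inf_{(x,y)\in\mathbb{Z}^2\setminus\{(0,0)\}}|ax^2+bxy+cy^2|}<\infty:\ a,b,c\in\mathbb{R},\ b^2-4ac=1\Big\}$$ the Markov spectrum. Let $J=(j_0,j_1)$ be the open interval with end points $$j_0=\lambda_0(\overline{33^*22212}),\qquad j_1=\lambda_0(\overline{21}\,12212332221233^*22212332221233321\,\overline{12}),$$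 and let $$\Upsilon=\lambda_0(\overline{3322212}\,33^*222123322212212121\,\overline{12}).$$ **Proposition.** $\Upsilon$ is the largest element of $(M\setminus L)\cap J$; that is, $\Upsilon\in (M\setminus L)\cap J$ and every $m\in(M\setminus L)\cap J$ satisfies $m\le\Upsilon$. Moreover, $\Upsilon=3.7096998597503806\dots$, that is, $3.7096998597503806\le\Upsilon<3.7096998597503807$. -/

import Mathlib

open Filter Topology

noncomputable section

namespace MarkovLagrange

/-- The Lagrange spectrum: the set of all finite values of
`limsup 1 / |q (q α - p)|`, as the integers `p, q` tend to infinity (in absolute value),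
for `α` irrational.  The upper limit is taken in the extended reals, so that finiteness is part
of the definition. -/
def lagrangeSpectrum : Set ℝ :=
  {x : ℝ | ∃ α : ℝ, Irrational α ∧
    limsup (fun pq : ℤ × ℤ => ((1 / |(pq.2 : ℝ) * ((pq.2 : ℝ) * α - (pq.1 : ℝ))| : ℝ) : EReal))
      ((cofinite : Filter ℤ) ×ˢ (cofinite : Filter ℤ)) = (x : EReal)}

/-- The infimum of `|a x² + b x y + c y²|` over the nonzero integer vectors `(x, y)`. -/
def formInf (a b c : ℝ) : ℝ :=
  ⨅ v : {v : ℤ × ℤ // v ≠ (0, 0)},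
    |a * (v.1.1 : ℝ) ^ 2 + b * (v.1.1 : ℝ) * (v.1.2 : ℝ) + c * (v.1.2 : ℝ) ^ 2|

/-- The Markov spectrum: the set of all finite values of `1 / inf |q(x, y)|`, where `q` is a real
binary quadratic form of discriminant `1` (such a form is automatically indefinite) and the infimum
is over the nonzero integer vectors; the value is finite exactly when the infimum is positive. -/
def markovSpectrum : Set ℝ :=
  {m : ℝ | ∃ a b c : ℝ, b ^ 2 - 4 * a * c = 1 ∧ 0 < formInf a b c ∧ m = 1 / formInf a b c}

/-- The finite continued fraction `[c 0; c 1, …, c n]`. -/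
def cfConvergent : ℕ → (ℕ → ℕ) → ℝ
  | 0, c => (c 0 : ℝ)
  | n + 1, c => (c 0 : ℝ) + 1 / cfConvergent n (fun k => c (k + 1))

/-- The infinite continued fraction `[c 0; c 1, c 2, …]`, the limit of its convergents (the limit
exists whenever `c k ≥ 1` for all `k ≥ 1`, which is the case in every use below). -/
def cfValue (c : ℕ → ℕ) : ℝ :=
  limUnder atTop (fun n => cfConvergent n c)

/-- `λ₀(a) = [a₀; a₁, a₂, …] + [0; a₋₁, a₋₂, …]` for a bi-infinite sequence `a`. -/
def lambdaZero (a : ℤ → ℕ) : ℝ :=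
  cfValue (fun k => a (k : ℤ)) + cfValue (fun k => if k = 0 then 0 else a (-(k : ℤ)))

/-- The bi-infinite sequence `… l l l w r r r …` (with `l` and `r` nonempty), whose position `0` is
the letter of index `z` of the word `w` (indices start at `0`). -/
def biSeq (l w r : List ℕ) (z : ℕ) (n : ℤ) : ℕ :=
  if n + z < 0 then l.getD ((n + z) % (l.length : ℤ)).toNat 0
  else if n + z < w.length then w.getD (n + z).toNat 0
  else r.getD ((n + z - w.length) % (r.length : ℤ)).toNat 0

/-- The left end point of `J`: `λ₀` of the periodic sequence with period `3 3* 2 2 2 1 2`. -/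
def j₀ : ℝ :=
  lambdaZero (biSeq [3, 3, 2, 2, 2, 1, 2] [3, 3, 2, 2, 2, 1, 2] [3, 3, 2, 2, 2, 1, 2] 1)

/-- The right end point of `J`: `λ₀` of the sequence
`(21)^∞ 12212332221233* 22212332221233321 (12)^∞`. -/
def j₁ : ℝ :=
  lambdaZero (biSeq [2, 1]
    [1, 2, 2, 1, 2, 3, 3, 2, 2, 2, 1, 2, 3, 3,
      2, 2, 2, 1, 2, 3, 3, 2, 2, 2, 1, 2, 3, 3, 3, 2, 1]
    [1, 2] 13)

/-- The open interval `J = (j₀, j₁)`. -/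
def J : Set ℝ := Set.Ioo j₀ j₁

/-- `Υ`: `λ₀` of the sequence `(3322212)^∞ 33* 222123322212212121 (12)^∞`. -/
def upsilon : ℝ :=
  lambdaZero (biSeq [3, 3, 2, 2, 2, 1, 2]
    [3, 3, 2, 2, 2, 1, 2, 3, 3, 2, 2, 2, 1, 2, 2, 1, 2, 1, 2, 1]
    [1, 2] 1)

end MarkovLagrange

end

noncomputable section

namespace MarkovLagrange

/-! Forms of discriminant 1 and irrational numbers are both encoded by sequences `a` of positive
integers, and the numbers to be studied are the values λ₀ of the shifts of `a`, here `chainValue X Z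
n`. Put T = `upperLevel`, which is at least j₁, and s = `lowerLevel`, which lies just below Υ.
Suppose that all values are below T. Then all letters are at most 3, and two exhaustive searches
with rational interval arithmetic give the facts that carry the proof.

Local uniqueness (`IsChain.local_uniqueness`): if the value at n exceeds s, then, up to reversal,
the word around n is 33222123 3* 222123322212212121.

Replication (`IsChain.hasWord_sub_seven`): the word 33222123 3* 22212332 at n forces the same word
at n - 7. Iteration makes everything to the left of n periodic with period 3322212.

Maximality: let the value at 0 exceed Υ. Up to reversal, the left half is that of Υ by replication
and the next 18 letters on the right are also those of Υ. Since 1 is never followed by 3, the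
remaining tail is at least [1; 2, 1, 2, …]. The common prefix has even length, so the right quotient
is at least that of Υ and the value is at most Υ, a contradiction (`IsChain.chainValue_le`).

Υ is not in L: if it were the limsup for some α, values in (s, T) would occur infinitely often along
the convergents, with the same orientation infinitely often. Two such occurrences, far apart, are
incompatible: replication from one makes the sequence periodic back to the other, whose long word
breaks the period (`IsChain.false_of_hasWord`).

Υ is in M: its sequence attains its largest value at position 0 (`chainValue_seqUpsilon_le`), and
the associated quadratic form has minimum 1/Υ.

Chains are indexed by a set S so that the same lemmas serve bi-infinite sequences and the one-sided
sequence of convergents, where the left quotients are ratios of consecutive denominators. -/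

/-! ### Interval arithmetic for continued fractions -/

/-- Numerators and denominators of a lower and an upper bound for a continued fraction that starts
with the given letters and whose next complete quotient lies in `[1, 4]`. -/
def cfBounds : List ℕ → ℕ × ℕ × ℕ × ℕ
  | [] => (1, 1, 4, 1)
  | a :: l =>
    match cfBounds l with
    | (ln, ld, hn, hd) => (a * hn + hd, hn, a * ln + ld, ln)

/-- Whether `c + 1 / [R] + 1 / [L] ≥ tn / td` for all admissible tails. -/
def tooBig (tn td : ℕ) (L : List ℕ) (c : ℕ) (R : List ℕ) : Bool :=
  match cfBounds L, cfBounds R with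
  | (_, _, p, q), (_, _, p', q') =>
    Nat.ble (tn * (p * p')) (td * (c * (p * p') + q * p' + q' * p))

/-- Whether `c + 1 / [R] + 1 / [L] ≤ tn / td` for all admissible tails. -/
def tooSmall (tn td : ℕ) (L : List ℕ) (c : ℕ) (R : List ℕ) : Bool :=
  match cfBounds L, cfBounds R with
  | (p, q, _, _), (p', q', _, _) =>
    Nat.ble (td * (c * (p * p') + q * p' + q' * p)) (tn * (p * p'))

/-- Whether some letter at or to the right of `c` has too large a value. -/
def someTooBig (tn td : ℕ) : List ℕ → ℕ → List ℕ → Bool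
  | L, c, [] => tooBig tn td L c []
  | L, c, r :: R => (Nat.beq c 3 && tooBig tn td L c (r :: R)) || someTooBig tn td (c :: L) r R

/-- Exhaustive search over the extensions of the word `L c R` (`L` is read from right to left). -/
def explore (tn td sn sd : ℕ) (goal : List ℕ → List ℕ → Bool) (c : ℕ) :
    ℕ → Bool → List ℕ → List ℕ → Bool
  | 0, _, _, _ => false
  | k + 1, side, L, R =>
    goal L R || tooSmall sn sd L c R || someTooBig tn td L c R || someTooBig tn td R c L ||
      (match side with
      | true => explore tn td sn sd goal c k false L (R ++ [1]) &&
          explore tn td sn sd goal c k false L (R ++ [2]) &&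
          explore tn td sn sd goal c k false L (R ++ [3])
      | false => explore tn td sn sd goal c k true (L ++ [1]) R &&
          explore tn td sn sd goal c k true (L ++ [2]) R &&
          explore tn td sn sd goal c k true (L ++ [3]) R)

/-- Words on the left are listed outward from the centre, so this is 33222123 as printed to the left
of the central 3. -/
def leftPattern : List ℕ := [3, 2, 1, 2, 2, 2, 3, 3]

def rightPattern : List ℕ := [2, 2, 2, 1, 2, 3, 3, 2]

def longRightPattern : List ℕ := [2, 2, 2, 1, 2, 3, 3, 2, 2, 2, 1, 2, 2, 1, 2, 1, 2, 1]

def uniquenessGoal (L R : List ℕ) : Bool :=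
  (leftPattern.isPrefixOf L && longRightPattern.isPrefixOf R) ||
    (leftPattern.isPrefixOf R && longRightPattern.isPrefixOf L)

/-- The first seven letters lead back to the previous central 3 at distance 7; `leftPattern` is then
required to the left of that 3. Its right-hand word is already known from the seven letters and the
old right pattern. -/
def replicationGoal (L _R : List ℕ) : Bool :=
  ([3, 2, 1, 2, 2, 2, 3] ++ leftPattern).isPrefixOf L

theorem explore_uniqueness : explore 370969985975042633 100000000000000000 37096998597503806 10000000000000000
    uniquenessGoal 3 40 true [] [] = true := by decide +kernel

theorem explore_center_one : explore 370969985975042633 100000000000000000 37096998597503806 10000000000000000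
    (fun _ _ => false) 1 40 true [] [] = true := by decide +kernel

theorem explore_center_two : explore 370969985975042633 100000000000000000 37096998597503806 10000000000000000
    (fun _ _ => false) 2 40 true [] [] = true := by decide +kernel

/-- The lower threshold 0/1 excludes nothing: replication depends only on the upper bound for the
values. -/
theorem explore_replication : explore 370969985975042633 100000000000000000 0 1
    replicationGoal 3 20 false leftPattern rightPattern = true := by decide +kernel

/-! ### Chains of complete quotients -/

/-- `X n` and `Z n` are the complete quotients of the sequence `a` at `n`, read to the right and
to the left, for the indices `n` in `S`. -/
structure IsChain (a : ℤ → ℕ) (X Z : ℤ → ℝ) (S : Set ℤ) : Prop where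
  right_eq : ∀ n ∈ S, X n = a n + 1 / X (n + 1)
  left_eq : ∀ n ∈ S, Z n = a n + 1 / Z (n - 1)
  one_le : ∀ n ∈ S, 1 ≤ a n
  right_pos : ∀ n ∈ S, 0 < X (n + 1)
  left_pos : ∀ n ∈ S, 0 < Z (n - 1)

namespace IsChain

variable {a : ℤ → ℕ} {X Z : ℤ → ℝ} {S : Set ℤ}

theorem mono {S' : Set ℤ} (h : IsChain a X Z S) (hS : S' ⊆ S) : IsChain a X Z S' :=
  ⟨fun n hn => h.right_eq n (hS hn), fun n hn => h.left_eq n (hS hn),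
    fun n hn => h.one_le n (hS hn), fun n hn => h.right_pos n (hS hn),
    fun n hn => h.left_pos n (hS hn)⟩

theorem reverse (h : IsChain a X Z S) :
    IsChain (fun n => a (-n)) (fun n => Z (-n)) (fun n => X (-n)) {n | -n ∈ S} where
  right_eq n hn := by
    have := h.left_eq (-n) hn
    rw [this, show -(n + 1) = -n - 1 by ring]
  left_eq n hn := by
    have := h.right_eq (-n) hn
    rw [this, show -(n - 1) = -n + 1 by ring]
  one_le n hn := h.one_le _ hn
  right_pos n hn := by
    have := h.left_pos (-n) hn
    rwa [show -(n + 1) = -n - 1 by ring]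
  left_pos n hn := by
    have := h.right_pos (-n) hn
    rwa [show -(n - 1) = -n + 1 by ring]

theorem one_le_right (h : IsChain a X Z S) {n : ℤ} (hn : n ∈ S) : 1 ≤ X n := by
  have h1 : (1 : ℝ) ≤ a n := by exact_mod_cast h.one_le n hn
  have := h.right_pos n hn
  rw [h.right_eq n hn]
  have : 0 < 1 / X (n + 1) := by positivity
  linarith

theorem one_le_left (h : IsChain a X Z S) {n : ℤ} (hn : n ∈ S) : 1 ≤ Z n := by
  have h1 : (1 : ℝ) ≤ a n := by exact_mod_cast h.one_le n hn
  have := h.left_pos n hn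
  rw [h.left_eq n hn]
  have : 0 < 1 / Z (n - 1) := by positivity
  linarith

end IsChain

/-- The value of the chain at `n`, written symmetrically. -/
def chainValue (X Z : ℤ → ℝ) (n : ℤ) : ℝ := X n + 1 / Z (n - 1)

theorem IsChain.chainValue_eq {a : ℤ → ℕ} {X Z : ℤ → ℝ} {S : Set ℤ} (h : IsChain a X Z S) {n : ℤ}
    (hn : n ∈ S) : chainValue X Z n = a n + 1 / X (n + 1) + 1 / Z (n - 1) := by
  rw [chainValue, h.right_eq n hn]

theorem IsChain.chainValue_reverse {a : ℤ → ℕ} {X Z : ℤ → ℝ} {S : Set ℤ} (h : IsChain a X Z S)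
    {n : ℤ} (hn : -n ∈ S) :
    chainValue (fun n => Z (-n)) (fun n => X (-n)) n = chainValue X Z (-n) := by
  rw [h.chainValue_eq hn, chainValue, h.left_eq _ hn, show -(n - 1) = -n + 1 by ring]
  ring

theorem IsChain.right_lt {a : ℤ → ℕ} {X Z : ℤ → ℝ} {S : Set ℤ} (h : IsChain a X Z S) {n : ℤ}
    (hn : n ∈ S) {t : ℝ} (ht : chainValue X Z n < t) : X n < t := by
  have := h.left_pos n hn
  have : 0 < 1 / Z (n - 1) := by positivity
  unfold chainValue at ht
  linarith

theorem IsChain.left_lt {a : ℤ → ℕ} {X Z : ℤ → ℝ} {S : Set ℤ} (h : IsChain a X Z S) {n : ℤ}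
    (hn : n ∈ S) {t : ℝ} (ht : chainValue X Z n < t) : Z n < t := by
  have := h.right_pos n hn
  have : 0 < 1 / X (n + 1) := by positivity
  rw [h.chainValue_eq hn] at ht
  rw [h.left_eq n hn]
  linarith

/-! ### Words in a sequence -/

/-- The letters of `R` are `a n, a (n + 1), …`. -/
def ReadsRight (a : ℤ → ℕ) : ℤ → List ℕ → Prop
  | _, [] => True
  | n, r :: R => a n = r ∧ ReadsRight a (n + 1) R

/-- The letters of `L` are `a n, a (n - 1), …`. -/
def ReadsLeft (a : ℤ → ℕ) : ℤ → List ℕ → Prop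
  | _, [] => True
  | n, l :: L => a n = l ∧ ReadsLeft a (n - 1) L

theorem readsRight_reverse {a : ℤ → ℕ} {R : List ℕ} {n : ℤ} :
    ReadsRight (fun n => a (-n)) n R ↔ ReadsLeft a (-n) R := by
  induction R generalizing n with
  | nil => simp [ReadsRight, ReadsLeft]
  | cons r R ih => simp only [ReadsRight, ReadsLeft, ih, show -(n + 1) = -n - 1 by ring]

theorem readsLeft_reverse {a : ℤ → ℕ} {R : List ℕ} {n : ℤ} :
    ReadsLeft (fun n => a (-n)) n R ↔ ReadsRight a (-n) R := by
  induction R generalizing n with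
  | nil => simp [ReadsRight, ReadsLeft]
  | cons r R ih => simp only [ReadsRight, ReadsLeft, ih, show -(n - 1) = -n + 1 by ring]

theorem readsRight_append {a : ℤ → ℕ} {R R' : List ℕ} {n : ℤ} :
    ReadsRight a n (R ++ R') ↔ ReadsRight a n R ∧ ReadsRight a (n + R.length) R' := by
  induction R generalizing n with
  | nil => simp [ReadsRight]
  | cons r R ih =>
    simp only [List.cons_append, ReadsRight, ih, List.length_cons, Nat.cast_add, Nat.cast_one,
      and_assoc, show n + 1 + (R.length : ℤ) = n + (R.length + 1) by ring]

theorem readsLeft_append {a : ℤ → ℕ} {R R' : List ℕ} {n : ℤ} :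
    ReadsLeft a n (R ++ R') ↔ ReadsLeft a n R ∧ ReadsLeft a (n - R.length) R' := by
  induction R generalizing n with
  | nil => simp [ReadsLeft]
  | cons r R ih =>
    simp only [List.cons_append, ReadsLeft, ih, List.length_cons, Nat.cast_add, Nat.cast_one,
      and_assoc, show n - 1 - (R.length : ℤ) = n - (R.length + 1) by ring]

theorem ReadsRight.of_isPrefixOf {a : ℤ → ℕ} {R R' : List ℕ} {n : ℤ} (h : ReadsRight a n R')
    (hp : R.isPrefixOf R' = true) : ReadsRight a n R := by
  obtain ⟨t, rfl⟩ := List.isPrefixOf_iff_prefix.1 hp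
  exact (readsRight_append.1 h).1

theorem ReadsLeft.of_isPrefixOf {a : ℤ → ℕ} {R R' : List ℕ} {n : ℤ} (h : ReadsLeft a n R')
    (hp : R.isPrefixOf R' = true) : ReadsLeft a n R := by
  obtain ⟨t, rfl⟩ := List.isPrefixOf_iff_prefix.1 hp
  exact (readsLeft_append.1 h).1

/-! ### Soundness of the interval arithmetic -/

/-- `x` lies in the interval described by the four numbers in `b`. -/
def InBounds (b : ℕ × ℕ × ℕ × ℕ) (x : ℝ) : Prop :=
  0 < b.1 ∧ 0 < b.2.1 ∧ 0 < b.2.2.1 ∧ 0 < b.2.2.2 ∧ (b.1 : ℝ) ≤ x * b.2.1 ∧ x * b.2.2.2 ≤ b.2.2.1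

theorem InBounds.cons {a : ℕ} {l : List ℕ} {x : ℝ} (hx : 0 < x) (h : InBounds (cfBounds l) x) :
    InBounds (cfBounds (a :: l)) (a + 1 / x) := by
  rcases hb : cfBounds l with ⟨ln, ld, hn, hd⟩
  rw [hb] at h
  obtain ⟨h1, h2, h3, h4, h5, h6⟩ := h
  simp only at h1 h2 h3 h4 h5 h6
  simp only [cfBounds, hb, InBounds]
  refine ⟨by positivity, h3, by positivity, h1, ?_, ?_⟩
  · have : (hd : ℝ) ≤ 1 / x * hn := by
      rw [div_mul_eq_mul_div, one_mul, le_div_iff₀ hx]; linarith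
    push_cast; linarith
  · have : 1 / x * ln ≤ (ld : ℝ) := by
      rw [div_mul_eq_mul_div, one_mul, div_le_iff₀ hx]; linarith
    push_cast; linarith

theorem InBounds.le_one_div {b : ℕ × ℕ × ℕ × ℕ} {x : ℝ} (hx : 0 < x) (h : InBounds b x) :
    (b.2.2.2 : ℝ) / b.2.2.1 ≤ 1 / x := by
  obtain ⟨h1, h2, h3, h4, h5, h6⟩ := h
  have : (0 : ℝ) < b.2.2.1 := by exact_mod_cast h3
  rw [div_le_div_iff₀ this hx]; linarith

theorem InBounds.one_div_le {b : ℕ × ℕ × ℕ × ℕ} {x : ℝ} (hx : 0 < x) (h : InBounds b x) :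
    1 / x ≤ (b.2.1 : ℝ) / b.1 := by
  obtain ⟨h1, h2, h3, h4, h5, h6⟩ := h
  have : (0 : ℝ) < b.1 := by exact_mod_cast h1
  rw [div_le_div_iff₀ hx this]; linarith

theorem inBounds_nil {x : ℝ} (h1 : 1 ≤ x) (h4 : x ≤ 4) : InBounds (cfBounds []) x := by
  simp only [InBounds, cfBounds]; norm_num; exact ⟨h1, h4⟩

theorem le_of_tooBig {tn td : ℕ} (htd : 0 < td) {L R : List ℕ} {c : ℕ} {x z : ℝ} (hx : 0 < x)
    (hz : 0 < z) (hL : InBounds (cfBounds L) z) (hR : InBounds (cfBounds R) x)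
    (h : tooBig tn td L c R = true) : (tn : ℝ) / td ≤ c + 1 / x + 1 / z := by
  have h1 := hL.le_one_div hz
  have h2 := hR.le_one_div hx
  obtain ⟨-, -, hp, -, -, -⟩ := hL
  obtain ⟨-, -, hp', -, -, -⟩ := hR
  simp only [tooBig, Nat.ble_eq] at h
  generalize cfBounds L = bL at *
  generalize cfBounds R = bR at *
  refine le_trans ?_ (add_le_add (add_le_add le_rfl h2) h1)
  have hp1 : (0 : ℝ) < bL.2.2.1 := by exact_mod_cast hp
  have hp2 : (0 : ℝ) < bR.2.2.1 := by exact_mod_cast hp'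
  have htd' : (0 : ℝ) < td := by exact_mod_cast htd
  have h' : (tn * (bL.2.2.1 * bR.2.2.1) : ℝ) ≤ td * (c * (bL.2.2.1 * bR.2.2.1)
    + bL.2.2.2 * bR.2.2.1 + bR.2.2.2 * bL.2.2.1) := by exact_mod_cast h
  have e : (c : ℝ) + bR.2.2.2 / bR.2.2.1 + bL.2.2.2 / bL.2.2.1 = (c * (bL.2.2.1 * bR.2.2.1)
    + bL.2.2.2 * bR.2.2.1 + bR.2.2.2 * bL.2.2.1) / (bL.2.2.1 * bR.2.2.1) := by
    field_simp; ring
  rw [e, div_le_div_iff₀ htd' (by positivity)]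
  linarith

theorem le_of_tooSmall {tn td : ℕ} (htd : 0 < td) {L R : List ℕ} {c : ℕ} {x z : ℝ} (hx : 0 < x)
    (hz : 0 < z) (hL : InBounds (cfBounds L) z) (hR : InBounds (cfBounds R) x)
    (h : tooSmall tn td L c R = true) : c + 1 / x + 1 / z ≤ (tn : ℝ) / td := by
  have h1 := hL.one_div_le hz
  have h2 := hR.one_div_le hx
  obtain ⟨hp, -, -, -, -, -⟩ := hL
  obtain ⟨hp', -, -, -, -, -⟩ := hR
  simp only [tooSmall, Nat.ble_eq] at h
  generalize cfBounds L = bL at *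
  generalize cfBounds R = bR at *
  refine le_trans (add_le_add (add_le_add le_rfl h2) h1) ?_
  have hp1 : (0 : ℝ) < bL.1 := by exact_mod_cast hp
  have hp2 : (0 : ℝ) < bR.1 := by exact_mod_cast hp'
  have htd' : (0 : ℝ) < td := by exact_mod_cast htd
  have h' : (td * (c * (bL.1 * bR.1)
    + bL.2.1 * bR.1 + bR.2.1 * bL.1) : ℝ) ≤ tn * (bL.1 * bR.1) := by exact_mod_cast h
  have e : (c : ℝ) + bR.2.1 / bR.1 + bL.2.1 / bL.1 = (c * (bL.1 * bR.1)
    + bL.2.1 * bR.1 + bR.2.1 * bL.1) / (bL.1 * bR.1) := by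
    field_simp; ring
  rw [e, div_le_div_iff₀ (by positivity) htd']
  linarith

theorem IsChain.digit_mem {a : ℤ → ℕ} {X Z : ℤ → ℝ} {S : Set ℤ} (h : IsChain a X Z S) {m : ℤ}
    (hm : m ∈ S) (hlt : chainValue X Z m < 4) : a m = 1 ∨ a m = 2 ∨ a m = 3 := by
  have h1 := h.one_le m hm
  have h2 : (a m : ℝ) < 4 := by
    have e := h.right_lt hm hlt
    have := h.right_pos m hm
    rw [h.right_eq m hm] at e
    have : 0 < 1 / X (m + 1) := by positivity
    linarith
  have h3 : a m < 4 := by exact_mod_cast h2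
  omega

section Soundness

variable {a : ℤ → ℕ} {X Z : ℤ → ℝ} {S : Set ℤ}

theorem IsChain.inBounds_right (h : IsChain a X Z S) {R : List ℕ} {n : ℤ} (hR : ReadsRight a n R)
    (hS : ∀ k, n ≤ k → k ≤ n + R.length → k ∈ S) (h4 : X (n + R.length) ≤ 4) :
    InBounds (cfBounds R) (X n) := by
  induction R generalizing n with
  | nil => exact inBounds_nil (h.one_le_right (hS n le_rfl (by simp))) (by simpa using h4)
  | cons r R ih =>
    have hn := hS n le_rfl (by omega)
    rw [h.right_eq n hn, hR.1]
    refine InBounds.cons (h.right_pos n hn) (ih hR.2 (fun k h1 h2 => hS k (by omega) ?_) ?_)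
    · simp only [List.length_cons]; omega
    · rwa [show n + 1 + (R.length : ℤ) = n + ((r :: R).length : ℤ) by
        simp only [List.length_cons]; push_cast; ring]

theorem IsChain.inBounds_left (h : IsChain a X Z S) {L : List ℕ} {n : ℤ} (hL : ReadsLeft a n L)
    (hS : ∀ k, n - L.length ≤ k → k ≤ n → k ∈ S) (h4 : Z (n - L.length) ≤ 4) :
    InBounds (cfBounds L) (Z n) := by
  have hr := h.reverse
  have := hr.inBounds_right (n := -n) (R := L) (by rwa [readsRight_reverse, neg_neg])
    (fun k h1 h2 => hS (-k) (by omega) (by omega))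
    (by rwa [show -(-n + (L.length : ℤ)) = n - L.length by ring])
  simpa using this

variable {tn td : ℕ}

theorem IsChain.not_tooBig (h : IsChain a X Z S) (htd : 0 < td) (ht4 : (tn : ℝ) / td ≤ 4)
    (hlt : ∀ n ∈ S, chainValue X Z n < (tn : ℝ) / td) {n : ℤ} {L R : List ℕ}
    (hL : ReadsLeft a (n - 1) L) (hR : ReadsRight a (n + 1) R)
    (hS : ∀ k, n - 1 - L.length ≤ k → k ≤ n + 1 + R.length → k ∈ S) :
    tooBig tn td L (a n) R = false := by
  have hn : n ∈ S := hS n (by omega) (by omega)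
  have hl : n - 1 - L.length ∈ S := hS _ le_rfl (by omega)
  have hr : n + 1 + R.length ∈ S := hS _ (by omega) le_rfl
  by_contra hc
  rw [Bool.not_eq_false] at hc
  have := le_of_tooBig htd (h.right_pos n hn) (h.left_pos n hn)
    (h.inBounds_left hL (fun k h1 h2 => hS k (by omega) (by omega))
      ((h.left_lt hl (hlt _ hl)).le.trans ht4))
    (h.inBounds_right hR (fun k h1 h2 => hS k (by omega) (by omega))
      ((h.right_lt hr (hlt _ hr)).le.trans ht4)) hc
  rw [← h.chainValue_eq hn] at this
  exact absurd (hlt n hn) (not_lt.2 this)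

/-- The test `Nat.beq c 3` merely skips checks that could not succeed in practice; skipping a check
weakens the pruning and leaves soundness intact. -/
theorem IsChain.not_someTooBig (h : IsChain a X Z S) (htd : 0 < td) (ht4 : (tn : ℝ) / td ≤ 4)
    (hlt : ∀ n ∈ S, chainValue X Z n < (tn : ℝ) / td) {n : ℤ} {L R : List ℕ}
    (hL : ReadsLeft a (n - 1) L) (hR : ReadsRight a (n + 1) R)
    (hS : ∀ k, n - 1 - L.length ≤ k → k ≤ n + 1 + R.length → k ∈ S) :
    someTooBig tn td L (a n) R = false := by
  induction R generalizing n L with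
  | nil => exact h.not_tooBig htd ht4 hlt hL hR hS
  | cons r R ih =>
    rw [someTooBig, h.not_tooBig htd ht4 hlt hL hR hS, Bool.and_false, Bool.false_or, ← hR.1]
    refine ih ⟨by congr 1; ring, by simpa using hL⟩ hR.2 (fun k h1 h2 => hS k ?_ ?_)
    · simp only [List.length_cons] at h1; omega
    · simp only [List.length_cons]; omega

theorem someTooBig_reverse (h : IsChain a X Z S) (htd : 0 < td) (ht4 : (tn : ℝ) / td ≤ 4)
    (hlt : ∀ n ∈ S, chainValue X Z n < (tn : ℝ) / td) {n : ℤ} {L R : List ℕ}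
    (hL : ReadsLeft a (n - 1) L) (hR : ReadsRight a (n + 1) R)
    (hS : ∀ k, n - 1 - L.length ≤ k → k ≤ n + 1 + R.length → k ∈ S) :
    someTooBig tn td R (a n) L = false := by
  have := h.reverse.not_someTooBig htd ht4 (n := -n) (L := R) (R := L)
    (fun k hk => by rw [h.chainValue_reverse hk]; exact hlt _ hk)
    (by rwa [readsLeft_reverse, show -(-n - 1) = n + 1 by ring])
    (by rwa [readsRight_reverse, show -(-n + 1) = n - 1 by ring])
    (fun k h1 h2 => hS (-k) (by omega) (by omega))
  simpa using this

/-- Soundness of the search: follow the branch given by the actual letters of `a`. It cannot be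
pruned, since the value at n exceeds the lower threshold and all values in S are below the upper
one, so it must end in the goal. Each unit of fuel adds one letter on one side, hence the margin k
in the window. -/
theorem IsChain.exists_goal (h : IsChain a X Z S) (htd : 0 < td) (ht4 : (tn : ℝ) / td < 4)
    (hlt : ∀ n ∈ S, chainValue X Z n < (tn : ℝ) / td) {sn sd : ℕ} (hsd : 0 < sd)
    {goal : List ℕ → List ℕ → Bool} {n : ℤ} (hgt : (sn : ℝ) / sd < chainValue X Z n)
    {k : ℕ} {side : Bool} {L R : List ℕ}
    (hL : ReadsLeft a (n - 1) L) (hR : ReadsRight a (n + 1) R)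
    (hS : ∀ j, n - 1 - L.length - k ≤ j → j ≤ n + 1 + R.length + k → j ∈ S)
    (he : explore tn td sn sd goal (a n) k side L R = true) :
    ∃ L' R', ReadsLeft a (n - 1) L' ∧ ReadsRight a (n + 1) R' ∧ goal L' R' = true := by
  induction k generalizing side L R with
  | zero => simp [explore] at he
  | succ k ih =>
    have hS0 : ∀ j, n - 1 - L.length ≤ j → j ≤ n + 1 + R.length → j ∈ S :=
      fun j h1 h2 => hS j (by omega) (by omega)
    have hn : n ∈ S := hS0 n (by omega) (by omega)
    have hl : n - 1 - L.length ∈ S := hS0 _ le_rfl (by omega)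
    have hr : n + 1 + R.length ∈ S := hS0 _ (by omega) le_rfl
    have hsmall : tooSmall sn sd L (a n) R = false := by
      by_contra hc
      rw [Bool.not_eq_false] at hc
      have := le_of_tooSmall hsd (h.right_pos n hn) (h.left_pos n hn)
        (h.inBounds_left hL (fun k h1 h2 => hS0 k (by omega) (by omega))
          ((h.left_lt hl (hlt _ hl)).le.trans ht4.le))
        (h.inBounds_right hR (fun k h1 h2 => hS0 k (by omega) (by omega))
          ((h.right_lt hr (hlt _ hr)).le.trans ht4.le)) hc
      rw [← h.chainValue_eq hn] at this
      exact absurd hgt (not_lt.2 this)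
    rw [explore.eq_def] at he
    simp only [] at he
    rw [hsmall, h.not_someTooBig htd ht4.le hlt hL hR hS0,
      someTooBig_reverse h htd ht4.le hlt hL hR hS0, Bool.or_false, Bool.or_false, Bool.or_false,
      Bool.or_eq_true] at he
    have digit := fun m hm => h.digit_mem (m := m) hm ((hlt m hm).trans ht4)
    rcases he with he | he
    · exact ⟨L, R, hL, hR, he⟩
    · cases side with
      | true =>
        simp only [Bool.and_eq_true] at he
        have key : explore tn td sn sd goal (a n) k false L (R ++ [a (n + 1 + R.length)]) = true := by
          rcases digit _ hr with e | e | e <;> rw [e]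
          exacts [he.1.1, he.1.2, he.2]
        refine ih hL ((readsRight_append (R' := [_])).2 ⟨hR, rfl, trivial⟩) (fun j h1 h2 => hS j ?_ ?_) key
        · push_cast; omega
        · simp only [List.length_append, List.length_singleton] at h2; push_cast at h2 ⊢; omega
      | false =>
        simp only [Bool.and_eq_true] at he
        have key : explore tn td sn sd goal (a n) k true (L ++ [a (n - 1 - L.length)]) R = true := by
          rcases digit _ hl with e | e | e <;> rw [e]
          exacts [he.1.1, he.1.2, he.2]
        refine ih ((readsLeft_append (R' := [_])).2 ⟨hL, rfl, trivial⟩) hR (fun j h1 h2 => hS j ?_ ?_) key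
        · simp only [List.length_append, List.length_singleton] at h1; push_cast at h1 ⊢; omega
        · push_cast; omega

end Soundness

/-! ### Local uniqueness and replication -/

/-- An upper bound for `j₁`. -/
def upperLevel : ℝ := (370969985975042633 : ℕ) / (100000000000000000 : ℕ)

/-- A lower bound for `upsilon`. -/
def lowerLevel : ℝ := (37096998597503806 : ℕ) / (10000000000000000 : ℕ)

section Uniqueness

variable {a : ℤ → ℕ} {X Z : ℤ → ℝ} {S : Set ℤ}

theorem upperLevel_lt_four : upperLevel < 4 := by unfold upperLevel; norm_num

theorem IsChain.local_uniqueness (h : IsChain a X Z S) (hlt : ∀ n ∈ S, chainValue X Z n < upperLevel)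
    {n : ℤ} (hgt : lowerLevel < chainValue X Z n) (hS : ∀ j, n - 50 ≤ j → j ≤ n + 50 → j ∈ S) :
    a n = 3 ∧
    ((ReadsLeft a (n - 1) leftPattern ∧ ReadsRight a (n + 1) longRightPattern) ∨
      (ReadsRight a (n + 1) leftPattern ∧ ReadsLeft a (n - 1) longRightPattern)) := by
  have hn : n ∈ S := hS n (by omega) (by omega)
  have key : ∀ goal, explore 370969985975042633 100000000000000000 37096998597503806
      10000000000000000 goal (a n) 40 true [] [] = true →
      ∃ L R, ReadsLeft a (n - 1) L ∧ ReadsRight a (n + 1) R ∧ goal L R = true := fun goal =>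
    h.exists_goal (by norm_num) upperLevel_lt_four hlt (by norm_num) hgt (L := []) (R := [])
      trivial trivial
      (fun j h1 h2 => hS j (by simp at h1; omega) (by simp at h2; omega))
  rcases h.digit_mem hn ((hlt n hn).trans upperLevel_lt_four) with e | e | e
  · obtain ⟨L, R, -, -, hg⟩ := key (fun _ _ => false) (by rw [e]; exact explore_center_one)
    simp at hg
  · obtain ⟨L, R, -, -, hg⟩ := key (fun _ _ => false) (by rw [e]; exact explore_center_two)
    simp at hg
  · obtain ⟨L, R, hL, hR, hg⟩ := key uniquenessGoal (by rw [e]; exact explore_uniqueness)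
    refine ⟨e, ?_⟩
    simp only [uniquenessGoal, Bool.or_eq_true, Bool.and_eq_true] at hg
    rcases hg with ⟨h1, h2⟩ | ⟨h1, h2⟩
    · exact Or.inl ⟨hL.of_isPrefixOf h1, hR.of_isPrefixOf h2⟩
    · exact Or.inr ⟨hR.of_isPrefixOf h1, hL.of_isPrefixOf h2⟩

/-- The word `33222123 3 22212332` around the position `n`. -/
def HasWord (a : ℤ → ℕ) (n : ℤ) : Prop :=
  a n = 3 ∧ ReadsLeft a (n - 1) leftPattern ∧ ReadsRight a (n + 1) rightPattern

theorem IsChain.hasWord_sub_seven (h : IsChain a X Z S)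
    (hlt : ∀ n ∈ S, chainValue X Z n < upperLevel) {n : ℤ}
    (hS : ∀ j, n - 30 ≤ j → j ≤ n + 30 → j ∈ S) (hw : HasWord a n) : HasWord a (n - 7) := by
  obtain ⟨h3, hL, hR⟩ := hw
  have hn : n ∈ S := hS n (by omega) (by omega)
  have hpos : ((0 : ℕ) : ℝ) / (1 : ℕ) < chainValue X Z n := by
    have h1 := h.one_le_right hn
    have := h.left_pos n hn
    have : 0 < 1 / Z (n - 1) := by positivity
    unfold chainValue
    norm_num
    simp only [one_div] at this
    linarith
  obtain ⟨L, R, hL', -, hg⟩ := h.exists_goal (by norm_num) upperLevel_lt_four hlt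
    (by norm_num) hpos hL hR
    (k := 20) (goal := replicationGoal) (fun j h1 h2 => hS j (by simp [leftPattern] at h1; omega)
      (by simp [rightPattern] at h2; omega)) (by rw [h3]; exact explore_replication)
  have := hL'.of_isPrefixOf hg
  simp only [leftPattern, rightPattern, List.cons_append, List.nil_append, ReadsLeft, ReadsRight,
    and_true] at this hR
  simp only [HasWord, leftPattern, rightPattern, ReadsLeft, ReadsRight, and_true]
  ring_nf at this hR h3 ⊢
  tauto

end Uniqueness

/-! ### Convergence of continued fractions -/

/-- The continued fraction `[c 0; c 1, …, c (n - 1), t]`. -/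
def cfTail : ℕ → (ℕ → ℕ) → ℝ → ℝ
  | 0, _, t => t
  | n + 1, c, t => c 0 + 1 / cfTail n (fun k => c (k + 1)) t

theorem cfConvergent_eq_cfTail (n : ℕ) (c : ℕ → ℕ) : cfConvergent n c = cfTail n c (c n) := by
  induction n generalizing c with
  | zero => rfl
  | succ n ih => rw [cfConvergent, ih, cfTail]

theorem cfTail_succ' (n : ℕ) (c : ℕ → ℕ) (t : ℝ) :
    cfTail (n + 1) c t = cfTail n c (c n + 1 / t) := by
  induction n generalizing c with
  | zero => rfl
  | succ n ih => rw [cfTail, ih, cfTail]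

theorem one_le_cfTail {n : ℕ} {c : ℕ → ℕ} (hc : ∀ k, 1 ≤ c k) {t : ℝ} (ht : 1 ≤ t) :
    1 ≤ cfTail n c t := by
  induction n generalizing c with
  | zero => exact ht
  | succ n ih =>
    have h1 := ih (fun k => hc (k + 1))
    have h2 : (1 : ℝ) ≤ c 0 := by exact_mod_cast hc 0
    have : 0 < 1 / cfTail n (fun k => c (k + 1)) t := by positivity
    rw [cfTail]; linarith

/-- Two steps of the expansion divide differences by (du + 1)(dv + 1) ≥ 4, so the contraction is by
1/2 per step on average. The factor 2 pays for a single step, which need not contract by 1/2. -/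
theorem abs_cfTail_sub_le {n : ℕ} {c : ℕ → ℕ} (hc : ∀ k, 1 ≤ c k) {s t : ℝ} (hs : 1 ≤ s)
    (ht : 1 ≤ t) : |cfTail n c s - cfTail n c t| ≤ 2 * |s - t| * (1 / 2) ^ n := by
  induction n using Nat.twoStepInduction generalizing c with
  | zero => simp only [cfTail, pow_zero]; linarith [abs_nonneg (s - t)]
  | one =>
    have : cfTail 1 c s - cfTail 1 c t = (t - s) / (s * t) := by
      simp only [cfTail]; field_simp; ring
    rw [this, abs_div, abs_sub_comm t s, abs_of_pos (by positivity : 0 < s * t),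
      div_le_iff₀ (by positivity)]
    nlinarith [abs_nonneg (s - t), mul_nonneg (sub_nonneg.2 hs) (sub_nonneg.2 ht)]
  | more n ih _ =>
    have hc' : ∀ k, 1 ≤ c (k + 1 + 1) := fun k => hc _
    have h := ih hc'
    have hu := one_le_cfTail (n := n) hc' hs
    have hv := one_le_cfTail (n := n) hc' ht
    have h1 : (1 : ℝ) ≤ c (0 + 1) := by exact_mod_cast hc _
    simp only [cfTail]
    set u := cfTail n (fun k => c (k + 1 + 1)) s
    set v := cfTail n (fun k => c (k + 1 + 1)) t
    set d : ℝ := (c (0 + 1) : ℝ)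
    have e : (c 0 : ℝ) + 1 / (d + 1 / u) - (c 0 + 1 / (d + 1 / v))
        = (u - v) / ((d * u + 1) * (d * v + 1)) := by
      field_simp; ring
    have h2 : 2 ≤ d * u + 1 := by nlinarith
    have h3 : 2 ≤ d * v + 1 := by nlinarith
    have h4 : 4 ≤ (d * u + 1) * (d * v + 1) := by nlinarith
    rw [e, abs_div, abs_of_pos (by linarith : 0 < (d * u + 1) * (d * v + 1)),
      div_le_iff₀ (by linarith)]
    have h5 : 0 ≤ 2 * |s - t| * (1 / 2) ^ n := by positivity
    calc |u - v| ≤ 2 * |s - t| * (1 / 2) ^ n := h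
      _ = 2 * |s - t| * (1 / 2) ^ (n + 2) * 4 := by ring
      _ ≤ _ := by gcongr

theorem tendsto_cfConvergent_of_eq {c : ℕ → ℕ} (hc : ∀ k, 1 ≤ c k) {x : ℕ → ℝ}
    (hx : ∀ n, x n = c n + 1 / x (n + 1)) (hpos : ∀ n, 0 < x n) :
    Tendsto (fun n => cfConvergent n c) atTop (𝓝 (x 0)) := by
  have hge : ∀ n, 1 ≤ x n := fun n => by
    have : (1 : ℝ) ≤ c n := by exact_mod_cast hc n
    have := hpos (n + 1)
    have : 0 < 1 / x (n + 1) := by positivity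
    rw [hx]; linarith
  have h0 : ∀ n, x 0 = cfTail n c (x n) := by
    intro n
    induction n with
    | zero => rfl
    | succ n ih => rw [ih, cfTail_succ', ← hx]
  rw [tendsto_iff_dist_tendsto_zero]
  have hlim : Tendsto (fun n : ℕ => 2 * (1 / 2 : ℝ) ^ n) atTop (𝓝 0) := by
    simpa using (tendsto_pow_atTop_nhds_zero_of_lt_one (r := (1 / 2 : ℝ)) (by norm_num)
      (by norm_num)).const_mul 2
  refine squeeze_zero (fun _ => dist_nonneg) (fun n => ?_) hlim
  have hcn : (1 : ℝ) ≤ c n := by exact_mod_cast hc n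
  rw [Real.dist_eq, cfConvergent_eq_cfTail, h0 n]
  refine (abs_cfTail_sub_le hc hcn (hge n)).trans ?_
  have h1 : |(c n : ℝ) - x n| ≤ 1 := by
    have h2 := hge (n + 1)
    have : 1 / x (n + 1) ≤ 1 := by rw [div_le_one (by linarith)]; exact h2
    have : 0 < 1 / x (n + 1) := by positivity
    rw [hx n, abs_le]; constructor <;> linarith
  gcongr
  linarith

theorem cfValue_eq_of_eq {c : ℕ → ℕ} (hc : ∀ k, 1 ≤ c k) {x : ℕ → ℝ}
    (hx : ∀ n, x n = c n + 1 / x (n + 1)) (hpos : ∀ n, 0 < x n) : cfValue c = x 0 :=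
  (tendsto_cfConvergent_of_eq hc hx hpos).limUnder_eq

theorem tendsto_cfConvergent {c : ℕ → ℕ} (hc : ∀ k, 1 ≤ c k) :
    Tendsto (fun n => cfConvergent n c) atTop (𝓝 (cfValue c)) := by
  have : CauchySeq (fun n => cfConvergent n c) := by
    refine cauchySeq_of_le_geometric (1 / 2) 2 (by norm_num) (fun n => ?_)
    have h1 : (1 : ℝ) ≤ c n := by exact_mod_cast hc n
    have h2 : (1 : ℝ) ≤ c (n + 1) := by exact_mod_cast hc (n + 1)
    have h3 : 0 < 1 / (c (n + 1) : ℝ) := by positivity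
    have h4 : 1 / (c (n + 1) : ℝ) ≤ 1 := by rw [div_le_one (by linarith)]; exact h2
    rw [Real.dist_eq, cfConvergent_eq_cfTail, cfConvergent_eq_cfTail, cfTail_succ']
    refine (abs_cfTail_sub_le hc h1 (by linarith)).trans ?_
    have : |(c n : ℝ) - (c n + 1 / c (n + 1))| ≤ 1 := by
      rw [abs_le]; constructor <;> linarith
    gcongr
    linarith
  obtain ⟨l, hl⟩ := cauchySeq_tendsto_of_complete this
  have : cfValue c = l := hl.limUnder_eq
  rwa [this]

theorem one_le_cfValue {c : ℕ → ℕ} (hc : ∀ k, 1 ≤ c k) : 1 ≤ cfValue c := by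
  refine ge_of_tendsto' (tendsto_cfConvergent hc) (fun n => ?_)
  rw [cfConvergent_eq_cfTail]
  exact one_le_cfTail hc (by exact_mod_cast hc n)

theorem cfValue_eq_add {c : ℕ → ℕ} (hc : ∀ k, 1 ≤ c (k + 1)) :
    cfValue c = c 0 + 1 / cfValue (fun k => c (k + 1)) := by
  have h1 := tendsto_cfConvergent hc
  have h2 := one_le_cfValue hc
  have h3 : Tendsto (fun n => cfConvergent (n + 1) c) atTop
      (𝓝 (c 0 + 1 / cfValue (fun k => c (k + 1)))) := by
    simp only [cfConvergent]
    exact tendsto_const_nhds.add (tendsto_const_nhds.div h1 (by linarith))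
  exact ((tendsto_add_atTop_iff_nat 1).1 h3).limUnder_eq

/-- The complete quotients of a sequence, to the right. -/
def rightQuotient (a : ℤ → ℕ) (n : ℤ) : ℝ := cfValue (fun k => a (n + k))

/-- The complete quotients of a sequence, to the left. -/
def leftQuotient (a : ℤ → ℕ) (n : ℤ) : ℝ := cfValue (fun k => a (n - k))

theorem isChain_quotients {a : ℤ → ℕ} (ha : ∀ n, 1 ≤ a n) :
    IsChain a (rightQuotient a) (leftQuotient a) Set.univ where
  right_eq n _ := by
    rw [rightQuotient, cfValue_eq_add (fun k => ha _), rightQuotient]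
    simp only [Nat.cast_add, Nat.cast_one, Nat.cast_zero, add_zero]
    congr 4; funext k; congr 1; ring
  left_eq n _ := by
    rw [leftQuotient, cfValue_eq_add (fun k => ha _), leftQuotient]
    simp only [Nat.cast_add, Nat.cast_one, Nat.cast_zero, sub_zero]
    congr 4; funext k; congr 1; ring
  one_le n _ := ha n
  right_pos n _ := zero_lt_one.trans_le (one_le_cfValue fun _ => ha _)
  left_pos n _ := zero_lt_one.trans_le (one_le_cfValue fun _ => ha _)

theorem lambdaZero_eq {a : ℤ → ℕ} (ha : ∀ n, 1 ≤ a n) :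
    lambdaZero a = chainValue (rightQuotient a) (leftQuotient a) 0 := by
  rw [lambdaZero, chainValue, rightQuotient, leftQuotient,
    cfValue_eq_add (c := fun k => if k = 0 then 0 else a (-(k : ℤ))) (fun k => by simp [ha])]
  simp only [Nat.add_eq_zero_iff, one_ne_zero, and_false, if_false, if_true, Nat.cast_zero,
    zero_add]
  congr 3; funext k; congr 1; push_cast; ring

/-- On all of ℤ the letters determine the quotients, because the expansion converges. This turns
agreement of the left halves into equality of left quotients. -/
theorem IsChain.left_eq_leftQuotient {a : ℤ → ℕ} {X Z : ℤ → ℝ} (h : IsChain a X Z Set.univ)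
    (n : ℤ) : Z n = leftQuotient a n := by
  have := cfValue_eq_of_eq (c := fun k => a (n - k)) (x := fun k => Z (n - k))
    (fun k => h.one_le _ trivial) (fun k => by
      rw [h.left_eq _ trivial]; push_cast; rw [sub_sub])
    (fun k => zero_lt_one.trans_le (h.one_le_left trivial))
  rw [leftQuotient, this]; simp

/-! ### Numerical values -/

section Numerics

variable {a : ℤ → ℕ}

theorem rightQuotient_le_four (h1 : ∀ n, 1 ≤ a n) (h3 : ∀ n, a n ≤ 3) (n : ℤ) :
    rightQuotient a n ≤ 4 := by
  have h := isChain_quotients h1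
  have h2 := h.one_le_right (Set.mem_univ (n + 1))
  have : (a n : ℝ) ≤ 3 := by exact_mod_cast h3 n
  have : 1 / rightQuotient a (n + 1) ≤ 1 := by rw [div_le_one (by linarith)]; exact h2
  rw [h.right_eq n trivial]; linarith

theorem leftQuotient_le_four (h1 : ∀ n, 1 ≤ a n) (h3 : ∀ n, a n ≤ 3) (n : ℤ) :
    leftQuotient a n ≤ 4 := by
  have h := isChain_quotients h1
  have h2 := h.one_le_left (Set.mem_univ (n - 1))
  have : (a n : ℝ) ≤ 3 := by exact_mod_cast h3 n
  have : 1 / leftQuotient a (n - 1) ≤ 1 := by rw [div_le_one (by linarith)]; exact h2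
  rw [h.left_eq n trivial]; linarith

theorem chainValue_le_of_tooSmall (h1 : ∀ n, 1 ≤ a n) (h3 : ∀ n, a n ≤ 3) {tn td : ℕ}
    (htd : 0 < td) {n : ℤ} {L R : List ℕ} (hL : ReadsLeft a (n - 1) L)
    (hR : ReadsRight a (n + 1) R) {c : ℕ} (hc : a n = c) (h : tooSmall tn td L c R = true) :
    chainValue (rightQuotient a) (leftQuotient a) n ≤ (tn : ℝ) / td := by
  have hch := isChain_quotients h1
  rw [hch.chainValue_eq trivial, hc]
  exact le_of_tooSmall htd (hch.right_pos n trivial) (hch.left_pos n trivial)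
    (hch.inBounds_left hL (fun _ _ _ => trivial) (leftQuotient_le_four h1 h3 _))
    (hch.inBounds_right hR (fun _ _ _ => trivial) (rightQuotient_le_four h1 h3 _)) h

theorem le_chainValue_of_tooBig (h1 : ∀ n, 1 ≤ a n) (h3 : ∀ n, a n ≤ 3) {tn td : ℕ}
    (htd : 0 < td) {n : ℤ} {L R : List ℕ} (hL : ReadsLeft a (n - 1) L)
    (hR : ReadsRight a (n + 1) R) {c : ℕ} (hc : a n = c) (h : tooBig tn td L c R = true) :
    (tn : ℝ) / td ≤ chainValue (rightQuotient a) (leftQuotient a) n := by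
  have hch := isChain_quotients h1
  rw [hch.chainValue_eq trivial, hc]
  exact le_of_tooBig htd (hch.right_pos n trivial) (hch.left_pos n trivial)
    (hch.inBounds_left hL (fun _ _ _ => trivial) (leftQuotient_le_four h1 h3 _))
    (hch.inBounds_right hR (fun _ _ _ => trivial) (rightQuotient_le_four h1 h3 _)) h

end Numerics

theorem getD_mem_of_forall {P : ℕ → Prop} {l : List ℕ} (h : ∀ x ∈ l, P x) {k : ℕ}
    (hk : k < l.length) : P (l.getD k 0) := by
  rw [List.getD_eq_getElem _ _ hk]; exact h _ (List.getElem_mem hk)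

theorem biSeq_forall {P : ℕ → Prop} {l w r : List ℕ} {z : ℕ} (hl : l ≠ []) (hr : r ≠ [])
    (h : ∀ x ∈ l ++ w ++ r, P x) (n : ℤ) : P (biSeq l w r z n) := by
  have hl' := List.length_pos_iff.2 hl
  have hr' := List.length_pos_iff.2 hr
  unfold biSeq
  split_ifs with h1 h2
  · refine getD_mem_of_forall (fun x hx => h x (by simp [hx])) ?_
    have := Int.emod_nonneg (n + z) (b := (l.length : ℤ)) (by omega)
    have := Int.emod_lt_of_pos (n + z) (b := (l.length : ℤ)) (by omega)
    omega
  · exact getD_mem_of_forall (fun x hx => h x (by simp [hx])) (by omega)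
  · refine getD_mem_of_forall (fun x hx => h x (by simp [hx])) ?_
    have := Int.emod_nonneg (n + z - w.length) (b := (r.length : ℤ)) (by omega)
    have := Int.emod_lt_of_pos (n + z - w.length) (b := (r.length : ℤ)) (by omega)
    omega

/-- The sequence that defines `j₀`. -/
def seqJ₀ : ℤ → ℕ := biSeq [3, 3, 2, 2, 2, 1, 2] [3, 3, 2, 2, 2, 1, 2] [3, 3, 2, 2, 2, 1, 2] 1

/-- The sequence that defines `j₁`. -/
def seqJ₁ : ℤ → ℕ := biSeq [2, 1]
    [1, 2, 2, 1, 2, 3, 3, 2, 2, 2, 1, 2, 3, 3,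
      2, 2, 2, 1, 2, 3, 3, 2, 2, 2, 1, 2, 3, 3, 3, 2, 1]
    [1, 2] 13

/-- The sequence that defines `upsilon`. -/
def seqUpsilon : ℤ → ℕ := biSeq [3, 3, 2, 2, 2, 1, 2]
    [3, 3, 2, 2, 2, 1, 2, 3, 3, 2, 2, 2, 1, 2, 2, 1, 2, 1, 2, 1]
    [1, 2] 1

theorem one_le_seqJ₀ : ∀ n, 1 ≤ seqJ₀ n := biSeq_forall (by simp) (by simp) (by simp)
theorem one_le_seqJ₁ : ∀ n, 1 ≤ seqJ₁ n := biSeq_forall (by simp) (by simp) (by simp)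
theorem one_le_seqUpsilon : ∀ n, 1 ≤ seqUpsilon n := biSeq_forall (by simp) (by simp) (by simp)
theorem seqJ₀_le_three : ∀ n, seqJ₀ n ≤ 3 :=
  biSeq_forall (P := (· ≤ 3)) (by simp) (by simp) (by simp)
theorem seqJ₁_le_three : ∀ n, seqJ₁ n ≤ 3 :=
  biSeq_forall (P := (· ≤ 3)) (by simp) (by simp) (by simp)
theorem seqUpsilon_le_three : ∀ n, seqUpsilon n ≤ 3 :=
  biSeq_forall (P := (· ≤ 3)) (by simp) (by simp) (by simp)

/-- The first `k` letters `a n, a (n + 1), …`. -/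
def takeRight (a : ℤ → ℕ) : ℕ → ℤ → List ℕ
  | 0, _ => []
  | k + 1, n => a n :: takeRight a k (n + 1)

/-- The first `k` letters `a n, a (n - 1), …`. -/
def takeLeft (a : ℤ → ℕ) : ℕ → ℤ → List ℕ
  | 0, _ => []
  | k + 1, n => a n :: takeLeft a k (n - 1)

theorem readsRight_takeRight (a : ℤ → ℕ) (k : ℕ) (n : ℤ) : ReadsRight a n (takeRight a k n) := by
  induction k generalizing n with
  | zero => trivial
  | succ k ih => exact ⟨rfl, ih _⟩

theorem readsLeft_takeLeft (a : ℤ → ℕ) (k : ℕ) (n : ℤ) : ReadsLeft a n (takeLeft a k n) := by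
  induction k generalizing n with
  | zero => trivial
  | succ k ih => exact ⟨rfl, ih _⟩

theorem j₀_le : j₀ ≤ (37096998597 : ℕ) / (10000000000 : ℕ) := by
  rw [show j₀ = lambdaZero seqJ₀ from rfl, lambdaZero_eq one_le_seqJ₀]
  exact chainValue_le_of_tooSmall one_le_seqJ₀ seqJ₀_le_three (by norm_num)
    (readsLeft_takeLeft _ 30 _) (readsRight_takeRight _ 30 _) rfl (by decide +kernel)

theorem le_j₁ : (3709699859750426 : ℕ) / (1000000000000000 : ℕ) ≤ j₁ := by
  rw [show j₁ = lambdaZero seqJ₁ from rfl, lambdaZero_eq one_le_seqJ₁]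
  exact le_chainValue_of_tooBig one_le_seqJ₁ seqJ₁_le_three (by norm_num)
    (readsLeft_takeLeft _ 40 _) (readsRight_takeRight _ 40 _) rfl (by decide +kernel)

theorem j₁_le : j₁ ≤ upperLevel := by
  rw [show j₁ = lambdaZero seqJ₁ from rfl, lambdaZero_eq one_le_seqJ₁]
  exact chainValue_le_of_tooSmall one_le_seqJ₁ seqJ₁_le_three (by norm_num)
    (readsLeft_takeLeft _ 50 _) (readsRight_takeRight _ 50 _) rfl (by decide +kernel)

theorem upsilon_eq :
    upsilon = chainValue (rightQuotient seqUpsilon) (leftQuotient seqUpsilon) 0 :=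
  lambdaZero_eq one_le_seqUpsilon

theorem le_upsilon : (370969985975038068 : ℕ) / (100000000000000000 : ℕ) ≤ upsilon := by
  rw [upsilon_eq]
  exact le_chainValue_of_tooBig one_le_seqUpsilon seqUpsilon_le_three (by norm_num)
    (readsLeft_takeLeft _ 50 _) (readsRight_takeRight _ 50 _) rfl (by decide +kernel)

theorem upsilon_le : upsilon ≤ (370969985975038069 : ℕ) / (100000000000000000 : ℕ) := by
  rw [upsilon_eq]
  exact chainValue_le_of_tooSmall one_le_seqUpsilon seqUpsilon_le_three (by norm_num)
    (readsLeft_takeLeft _ 50 _) (readsRight_takeRight _ 50 _) rfl (by decide +kernel)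

theorem upsilon_mem_J : upsilon ∈ J := by
  refine ⟨j₀_le.trans_lt (lt_of_lt_of_le ?_ le_upsilon),
    upsilon_le.trans_lt (lt_of_lt_of_le ?_ le_j₁)⟩ <;> norm_num

theorem lowerLevel_lt_upsilon : lowerLevel < upsilon := by
  refine lt_of_lt_of_le ?_ le_upsilon
  unfold lowerLevel; norm_num

theorem upsilon_lt_upperLevel : upsilon < upperLevel :=
  upsilon_mem_J.2.trans_le j₁_le

/-! ### The sequence of `upsilon` -/

/-- The central word opens with two further copies of the period, so the periodic part reaches up to
position 12; position 13 carries a 2 where the period would have a 3. -/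
theorem seqUpsilon_of_le {n : ℤ} (hn : n ≤ 12) :
    seqUpsilon n = [3, 3, 2, 2, 2, 1, 2].getD ((n + 1) % 7).toNat 0 := by
  unfold seqUpsilon biSeq
  simp only [List.length_cons, List.length_nil]
  rcases lt_or_ge (n + 1) 0 with h | h
  · simp [h]
  · obtain ⟨k, hk⟩ := Int.eq_ofNat_of_zero_le h
    have hk' : k ≤ 13 := by omega
    rw [show n = k - 1 by omega]
    interval_cases k <;> rfl

theorem seqUpsilon_add {n m : ℤ} (hm : m ≤ 12) (k : ℕ) (h : n = m - 7 * k) :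
    seqUpsilon n = seqUpsilon m := by
  rw [seqUpsilon_of_le hm, seqUpsilon_of_le (by omega)]
  congr 2; omega

theorem seqUpsilon_of_ge {n : ℤ} (hn : 19 ≤ n) :
    seqUpsilon n = if n % 2 = 1 then 1 else 2 := by
  unfold seqUpsilon biSeq
  simp only [List.length_cons, List.length_nil]
  rw [if_neg (by omega), if_neg (by push_cast; omega)]
  split_ifs with h
  · rw [show (n + (1 : ℕ) - ((0 + 1 + 1 + 1 + 1 + 1 + 1 + 1 + 1 + 1 + 1 + 1 + 1 + 1 + 1 + 1 + 1 + 1 +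
      1 + 1 + 1 : ℕ) : ℤ)) % ((0 + 1 + 1 : ℕ) : ℤ) = 0 by push_cast; omega]
    rfl
  · rw [show (n + (1 : ℕ) - ((0 + 1 + 1 + 1 + 1 + 1 + 1 + 1 + 1 + 1 + 1 + 1 + 1 + 1 + 1 + 1 + 1 + 1 +
      1 + 1 + 1 : ℕ) : ℤ)) % ((0 + 1 + 1 : ℕ) : ℤ) = 1 by push_cast; omega]
    rfl

theorem seqUpsilon_eq_three {n : ℤ} (h : seqUpsilon n = 3) :
    n = 6 ∨ n = 7 ∨ ∃ k : ℕ, n = -7 * k ∨ n = -7 * k - 1 := by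
  rcases le_or_gt n 12 with h12 | h12
  · rw [seqUpsilon_of_le h12] at h
    have h0 := Int.emod_nonneg (n + 1) (b := 7) (by norm_num)
    have h1 := Int.emod_lt_of_pos (n + 1) (b := 7) (by norm_num)
    obtain ⟨r, hr⟩ := Int.eq_ofNat_of_zero_le h0
    rw [hr] at h
    have hr7 : r < 7 := by omega
    have hr2 : r = 0 ∨ r = 1 := by
      interval_cases r <;> simp at h ⊢
    by_cases h7 : 6 ≤ n
    · omega
    · refine Or.inr (Or.inr ⟨((-n) / 7).toNat, ?_⟩)
      omega
  · exfalso
    rcases lt_or_ge n 19 with h19 | h19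
    · obtain ⟨k, rfl⟩ := Int.eq_ofNat_of_zero_le (by omega : 0 ≤ n)
      have h13 : 12 < k := by omega
      have h19' : k < 19 := by omega
      interval_cases k <;> revert h <;> decide
    · rw [seqUpsilon_of_ge h19] at h
      split_ifs at h <;> simp at h

theorem rightQuotient_congr {a b : ℤ → ℕ} {n m : ℤ} (h : ∀ k : ℕ, a (n + k) = b (m + k)) :
    rightQuotient a n = rightQuotient b m := by
  unfold rightQuotient; congr 1; funext k; exact h k

theorem leftQuotient_congr {a b : ℤ → ℕ} {n m : ℤ} (h : ∀ k : ℕ, a (n - k) = b (m - k)) :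
    leftQuotient a n = leftQuotient b m := by
  unfold leftQuotient; congr 1; funext k; exact h k

theorem readsRight_seqUpsilon (k : ℕ) :
    ReadsRight seqUpsilon (-7 * (k + 1) + 1) [2, 2, 2, 1, 2, 3, 3, 2, 2, 2, 1, 2, 3, 3] := by
  exact ⟨
    seqUpsilon_add (m := -6) (by norm_num) k (by ring),
    seqUpsilon_add (m := -5) (by norm_num) k (by ring),
    seqUpsilon_add (m := -4) (by norm_num) k (by ring),
    seqUpsilon_add (m := -3) (by norm_num) k (by ring),
    seqUpsilon_add (m := -2) (by norm_num) k (by ring),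
    seqUpsilon_add (m := -1) (by norm_num) k (by ring),
    seqUpsilon_add (m := 0) (by norm_num) k (by ring),
    seqUpsilon_add (m := 1) (by norm_num) k (by ring),
    seqUpsilon_add (m := 2) (by norm_num) k (by ring),
    seqUpsilon_add (m := 3) (by norm_num) k (by ring),
    seqUpsilon_add (m := 4) (by norm_num) k (by ring),
    seqUpsilon_add (m := 5) (by norm_num) k (by ring),
    seqUpsilon_add (m := 6) (by norm_num) k (by ring),
    seqUpsilon_add (m := 7) (by norm_num) k (by ring), trivial⟩

/-- Only letters 3 compete. Those at 6, 7 and -7k - 1 have values below `lowerLevel`. Those at -7k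
share the left half with position 0 and lose on the right. -/
theorem chainValue_seqUpsilon_le (n : ℤ) :
    chainValue (rightQuotient seqUpsilon) (leftQuotient seqUpsilon) n ≤ upsilon := by
  have hch := isChain_quotients one_le_seqUpsilon
  have h4X := rightQuotient_le_four one_le_seqUpsilon seqUpsilon_le_three
  have h4Z := leftQuotient_le_four one_le_seqUpsilon seqUpsilon_le_three
  by_cases h3 : seqUpsilon n = 3
  swap
  · have h2 : seqUpsilon n ≤ 2 := by have := seqUpsilon_le_three n; omega
    refine le_trans ?_ le_upsilon
    rw [hch.chainValue_eq trivial]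
    have h2' : (seqUpsilon n : ℝ) ≤ 2 := by exact_mod_cast h2
    have hX1 : 5 / 4 ≤ rightQuotient seqUpsilon (n + 1) := by
      have h1 : (1 : ℝ) ≤ seqUpsilon (n + 1) := by exact_mod_cast one_le_seqUpsilon _
      have h5 := one_div_le_one_div_of_le (hch.right_pos (n + 1) trivial) (h4X (n + 1 + 1))
      rw [hch.right_eq _ trivial]; linarith
    have hZ1 : 5 / 4 ≤ leftQuotient seqUpsilon (n - 1) := by
      have h1 : (1 : ℝ) ≤ seqUpsilon (n - 1) := by exact_mod_cast one_le_seqUpsilon _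
      have h5 := one_div_le_one_div_of_le (hch.left_pos (n - 1) trivial) (h4Z (n - 1 - 1))
      rw [hch.left_eq _ trivial]; linarith
    -- For a letter at most 2 the value is at most 2 + 4/5 + 4/5 = 3.6.
    have e1 := one_div_le_one_div_of_le (by norm_num) hX1
    have e2 := one_div_le_one_div_of_le (by norm_num) hZ1
    norm_num at e1 e2 ⊢
    linarith
  · rcases seqUpsilon_eq_three h3 with rfl | rfl | ⟨k, rfl | rfl⟩
    · refine le_trans ?_ lowerLevel_lt_upsilon.le
      exact chainValue_le_of_tooSmall one_le_seqUpsilon seqUpsilon_le_three (by norm_num)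
        (readsLeft_takeLeft _ 30 _) (readsRight_takeRight _ 30 _) rfl (by decide +kernel)
    · refine le_trans ?_ lowerLevel_lt_upsilon.le
      exact chainValue_le_of_tooSmall one_le_seqUpsilon seqUpsilon_le_three (by norm_num)
        (readsLeft_takeLeft _ 30 _) (readsRight_takeRight _ 30 _) rfl (by decide +kernel)
    · obtain _ | k := k
      · rw [upsilon_eq]; simp
      rw [upsilon_eq, hch.chainValue_eq trivial, hch.chainValue_eq trivial, h3,
        show seqUpsilon 0 = 3 from rfl]
      have hZ : leftQuotient seqUpsilon (-7 * ((k + 1 : ℕ) : ℤ) - 1)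
          = leftQuotient seqUpsilon (0 - 1) :=
        leftQuotient_congr fun j => seqUpsilon_add (by omega) (k + 1) (by push_cast; ring)
      -- The two right halves first differ in their 13th letter, 2 at position 0 against 3 at -7(k +
      -- 1). At an odd place a larger letter gives a larger quotient, hence a smaller reciprocal; 14
      -- letters suffice to separate the intervals.
      have hX := (hch.inBounds_right (n := 0 + 1) (readsRight_takeRight _ 14 _)
        (fun _ _ _ => trivial) (h4X _)).le_one_div (hch.right_pos 0 trivial)
      have hX' := (hch.inBounds_right (readsRight_seqUpsilon k)
        (fun _ _ _ => trivial) (h4X _)).one_div_le (hch.right_pos _ trivial)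
      rw [hZ]
      push_cast at hX' ⊢
      gcongr 3 + ?_ + _
      refine hX'.trans (le_trans ?_ hX)
      rw [show takeRight seqUpsilon 14 (0 + 1) = [2, 2, 2, 1, 2, 3, 3, 2, 2, 2, 1, 2, 2, 1] from rfl]
      simp only [cfBounds]
      norm_num
    · refine le_trans ?_ lowerLevel_lt_upsilon.le
      refine chainValue_le_of_tooSmall one_le_seqUpsilon seqUpsilon_le_three (by norm_num)
        (L := [2, 1, 2]) (R := [3, 2, 2]) ?_ ?_ h3 (by decide +kernel)
      · exact ⟨seqUpsilon_add (m := -2) (by norm_num) k (by ring),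
          seqUpsilon_add (m := -3) (by norm_num) k (by ring),
          seqUpsilon_add (m := -4) (by norm_num) k (by ring), trivial⟩
      · exact ⟨seqUpsilon_add (m := 0) (by norm_num) k (by ring),
          seqUpsilon_add (m := 1) (by norm_num) k (by ring),
          seqUpsilon_add (m := 2) (by norm_num) k (by ring), trivial⟩

/-! ### Sequences whose values exceed `upsilon` -/

section Maximality

variable {a : ℤ → ℕ} {X Z : ℤ → ℝ}

theorem IsChain.hasWord_sub {S : Set ℤ} (h : IsChain a X Z S)
    (hlt : ∀ n ∈ S, chainValue X Z n < upperLevel) {n : ℤ} (hw : HasWord a n) (k : ℕ)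
    (hS : ∀ j, n - 7 * k - 30 ≤ j → j ≤ n + 30 → j ∈ S) : HasWord a (n - 7 * k) := by
  induction k with
  | zero => simpa using hw
  | succ k ih =>
    have := h.hasWord_sub_seven hlt (fun j h1 h2 => hS j (by push_cast; omega) (by omega))
      (ih (fun j h1 h2 => hS j (by push_cast; omega) h2))
    rwa [show n - 7 * ((k + 1 : ℕ) : ℤ) = n - 7 * k - 7 by push_cast; ring]

theorem hasWord_of_long {n : ℤ} (h3 : a n = 3) (hL : ReadsLeft a (n - 1) leftPattern)
    (hR : ReadsRight a (n + 1) longRightPattern) : HasWord a n :=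
  ⟨h3, hL, hR.of_isPrefixOf (by decide)⟩

/-- The letters at and before a position with the word `33222123 3 22212332`. -/
theorem HasWord.eq_seqUpsilon {n : ℤ} (hw : HasWord a n) {r : ℕ} (hr : r < 7) :
    a (n - r) = seqUpsilon (-r) := by
  obtain ⟨h3, hL, -⟩ := hw
  simp only [leftPattern, ReadsLeft, and_true, sub_sub] at hL
  norm_num at hL
  interval_cases r
  · rw [Nat.cast_zero, sub_zero, h3]; rfl
  · exact hL.1
  · exact hL.2.1
  · exact hL.2.2.1
  · exact hL.2.2.2.1
  · exact hL.2.2.2.2.1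
  · exact hL.2.2.2.2.2.1

/-- Each common letter reverses the order of the quotients, so a common prefix of even length
preserves it. -/
theorem right_le_of_readsRight {b : ℤ → ℕ} {X' Z' : ℤ → ℝ} (h : IsChain a X Z Set.univ)
    (h' : IsChain b X' Z' Set.univ) {R : List ℕ} {n m : ℤ} (hR : ReadsRight a n R)
    (hR' : ReadsRight b m R) (heven : Even R.length)
    (hle : X (n + R.length) ≤ X' (m + R.length)) : X n ≤ X' m := by
  induction R using List.twoStepInduction generalizing n m with
  | nil => simpa using hle
  | singleton => simp at heven
  | cons_cons r s R ih _ =>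
    have key : X (n + 1 + 1) ≤ X' (m + 1 + 1) := by
      refine ih hR.2.2 hR'.2.2 ?_ ?_
      · simpa [Nat.even_add_one] using heven
      · simp only [List.length_cons] at hle
        push_cast at hle
        rwa [show n + 1 + 1 + (R.length : ℤ) = n + (R.length + 1 + 1) by ring,
          show m + 1 + 1 + (R.length : ℤ) = m + (R.length + 1 + 1) by ring]
    have h1 := h.right_pos (n + 1) trivial
    have h2 := h.right_pos n trivial
    have h3 := h'.right_pos m trivial
    rw [h.right_eq n trivial, h'.right_eq m trivial, hR.1, hR'.1]
    gcongr
    rw [h.right_eq (n + 1) trivial, h'.right_eq (m + 1) trivial, hR.2.1, hR'.2.1]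
    gcongr

/-- A letter 3 or more after a 1 would have value at least 3 + 1/2 + 1/4. -/
theorem IsChain.le_two_of_eq_one (h : IsChain a X Z Set.univ)
    (hlt : ∀ n, chainValue X Z n < upperLevel) {n : ℤ} (h1 : a n = 1) : a (n + 1) ≤ 2 := by
  by_contra hc
  have h3 : (3 : ℝ) ≤ a (n + 1) := by exact_mod_cast (by omega : 3 ≤ a (n + 1))
  have hv := hlt (n + 1)
  have hX4 := (h.right_lt trivial (hlt (n + 1 + 1))).trans upperLevel_lt_four
  have hX := h.right_pos (n + 1) trivial
  have hZ := h.left_pos (n + 1) trivial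
  rw [h.chainValue_eq trivial, show n + 1 - 1 = n by ring] at hv
  rw [show n + 1 - 1 = n by ring] at hZ
  have hZ1 := h.one_le_left (n := n - 1) trivial
  have hZ2 : Z n ≤ 2 := by
    have : 1 / Z (n - 1) ≤ 1 := by rw [div_le_one (by linarith)]; exact hZ1
    rw [h.left_eq n trivial, h1]; push_cast; linarith
  have e1 := one_div_le_one_div_of_le hX hX4.le
  have e2 := one_div_le_one_div_of_le hZ hZ2
  have : upperLevel < 3.71 := by unfold upperLevel; norm_num
  linarith

/-- No complete quotient is smaller than `[1; 2, 1, 2, …]`. -/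
theorem IsChain.le_right (h : IsChain a X Z Set.univ) (hlt : ∀ n, chainValue X Z n < upperLevel)
    {t : ℝ} (ht : 0 < t) (ht2 : t = 1 + 1 / (2 + 1 / t)) (n : ℤ) : t ≤ X n := by
  have hbdd : BddBelow (Set.range X) := ⟨1, by rintro _ ⟨k, rfl⟩; exact h.one_le_right trivial⟩
  set I := ⨅ k, X k with hI
  have hI1 : 1 ≤ I := le_ciInf fun k => h.one_le_right trivial
  have hIle : ∀ k, I ≤ X k := fun k => ciInf_le hbdd k
  have hquad : 2 * t ^ 2 - 2 * t - 1 = 0 := by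
    field_simp at ht2
    nlinarith
  -- The infimum I of all quotients need not be attained, but it satisfies the inequality 2I² - 2I -
  -- 1 ≥ 0, whose equality case has t as positive root.
  have key : 1 + 1 / (2 + 1 / I) ≤ I := by
    refine le_ciInf fun k => ?_
    have hk := h.right_pos k trivial
    have hpos : 0 < 1 / I := by positivity
    have h1 : 1 / (2 + 1 / I) ≤ 1 := by rw [div_le_one (by linarith)]; linarith
    rcases Nat.lt_or_ge (a k) 2 with h2 | h2
    · have ha : a k = 1 := by have := h.one_le k trivial; omega
      have h3 : (a (k + 1) : ℝ) ≤ 2 := by exact_mod_cast h.le_two_of_eq_one hlt ha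
      have h4 : X (k + 1) ≤ 2 + 1 / I := by
        rw [h.right_eq (k + 1) trivial]
        have := one_div_le_one_div_of_le (by linarith) (hIle (k + 1 + 1))
        linarith
      have := one_div_le_one_div_of_le hk h4
      rw [h.right_eq k trivial, ha]; push_cast; linarith
    · have : (2 : ℝ) ≤ a k := by exact_mod_cast h2
      have : 0 < 1 / X (k + 1) := by positivity
      rw [h.right_eq k trivial]; linarith
  refine le_trans ?_ (hIle n)
  have hI0 : 0 < I := by linarith
  have e : 1 + 1 / (2 + 1 / I) = (3 * I + 1) / (2 * I + 1) := by field_simp; ring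
  rw [e, div_le_iff₀ (by linarith)] at key
  by_contra hc
  push Not at hc
  nlinarith

theorem rightQuotient_seqUpsilon_tail :
    rightQuotient seqUpsilon 19 = 1 + 1 / (2 + 1 / rightQuotient seqUpsilon 19) := by
  have h := isChain_quotients one_le_seqUpsilon
  have e : rightQuotient seqUpsilon 21 = rightQuotient seqUpsilon 19 :=
    rightQuotient_congr fun k => by
      rw [seqUpsilon_of_ge (by omega), seqUpsilon_of_ge (by omega)]
      congr 2; omega
  conv_lhs => rw [h.right_eq 19 trivial, h.right_eq (19 + 1) trivial,
    show (19 + 1 + 1 : ℤ) = 21 by norm_num, e, show seqUpsilon 19 = 1 from rfl,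
    show seqUpsilon (19 + 1) = 2 from rfl]
  norm_num

theorem IsChain.chainValue_le_of_left (h : IsChain a X Z Set.univ)
    (hlt : ∀ n, chainValue X Z n < upperLevel) (h3 : a 0 = 3)
    (hL : ReadsLeft a (0 - 1) leftPattern) (hR : ReadsRight a (0 + 1) longRightPattern) :
    chainValue X Z 0 ≤ upsilon := by
  have hU := isChain_quotients one_le_seqUpsilon
  have hw := hasWord_of_long h3 hL hR
  have hleft : ∀ m : ℕ, a (-m) = seqUpsilon (-m) := by
    intro m
    -- Replicate m / 7 times, then read the remaining m % 7 letters off the word.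
    have h1 := h.hasWord_sub (fun n _ => hlt n) hw (m / 7) (fun _ _ _ => trivial)
    have h2 := h1.eq_seqUpsilon (r := m % 7) (Nat.mod_lt _ (by norm_num))
    rw [show (0 : ℤ) - 7 * ((m / 7 : ℕ) : ℤ) - ((m % 7 : ℕ) : ℤ) = -m by omega] at h2
    rw [h2]
    exact (seqUpsilon_add (by omega) (m / 7) (by omega)).symm
  have hZ : Z (0 - 1) = leftQuotient seqUpsilon (0 - 1) := by
    rw [h.left_eq_leftQuotient]
    refine leftQuotient_congr fun k => ?_
    rw [show (0 : ℤ) - 1 - k = -((k + 1 : ℕ) : ℤ) by push_cast; ring]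
    exact hleft _
  have hX : rightQuotient seqUpsilon (0 + 1) ≤ X (0 + 1) := by
    refine right_le_of_readsRight hU h (R := longRightPattern) (readsRight_takeRight _ 18 _) hR
      (by decide) ?_
    exact h.le_right hlt (hU.right_pos 18 trivial) rightQuotient_seqUpsilon_tail _
  rw [upsilon_eq, h.chainValue_eq trivial, hU.chainValue_eq trivial, hZ, h3,
    show seqUpsilon 0 = 3 from rfl]
  gcongr
  exact hU.right_pos 0 trivial

theorem IsChain.chainValue_le (h : IsChain a X Z Set.univ)
    (hlt : ∀ n, chainValue X Z n < upperLevel) : chainValue X Z 0 ≤ upsilon := by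
  by_contra hc
  push Not at hc
  obtain ⟨h3, hw | hw⟩ := h.local_uniqueness (fun n _ => hlt n) (lowerLevel_lt_upsilon.trans hc)
    (fun _ _ _ => trivial)
  · exact hc.not_ge (h.chainValue_le_of_left hlt h3 hw.1 hw.2)
  · have hrev := h.reverse.mono (S' := Set.univ) (fun _ _ => trivial)
    have hval := fun n => h.chainValue_reverse (n := n) trivial
    have := hrev.chainValue_le_of_left (fun n => by rw [hval]; exact hlt _) (by simpa using h3)
      (by rw [readsLeft_reverse]; exact hw.1) (by rw [readsRight_reverse]; exact hw.2)
    rw [hval, neg_zero] at this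
    exact hc.not_ge this

end Maximality

/-! ### Best approximations -/

/-- If `(l₀, l₁)` have opposite signs and `m₀, m₁ ≥ 0`, then a lattice vector on which the first
linear form is smaller than `|l₀|` has second linear form at least `m₁`. -/
theorem best_approximation {l₀ l₁ m₀ m₁ : ℝ} (hl : l₀ * l₁ ≤ 0) (hm₀ : 0 ≤ m₀) (hm₁ : 0 ≤ m₁)
    {s t : ℤ} (hne : ¬(s = 0 ∧ t = 0)) (hlt : |s * l₀ + t * l₁| < |l₀|) :
    m₁ ≤ |s * m₀ + t * m₁| := by
  wlog ht : 0 ≤ t generalizing s t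
  · have := @this (-s) (-t) (by simpa using hne) (by
      push_cast
      rwa [show -(s : ℝ) * l₀ + -t * l₁ = -(s * l₀ + t * l₁) by ring, abs_neg]) (by omega)
    push_cast at this
    rwa [show -(s : ℝ) * m₀ + -t * m₁ = -(s * m₀ + t * m₁) by ring, abs_neg] at this
  have hl0 : 0 < |l₀| := (abs_nonneg _).trans_lt hlt
  rcases ht.eq_or_lt with rfl | ht
  · have hs : s ≠ 0 := fun h => hne ⟨h, rfl⟩
    have : (1 : ℝ) ≤ |(s : ℝ)| := by exact_mod_cast Int.one_le_abs hs
    simp only [Int.cast_zero, zero_mul, add_zero, abs_mul] at hlt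
    nlinarith
  have ht1 : (1 : ℝ) ≤ t := by exact_mod_cast ht
  rcases le_or_gt 0 s with hs | hs
  · have hs0 : (0 : ℝ) ≤ s := by exact_mod_cast hs
    refine le_trans ?_ (le_abs_self _)
    nlinarith [mul_nonneg hs0 hm₀]
  · exfalso
    have hs1 : (s : ℝ) ≤ -1 := by exact_mod_cast (by omega : s ≤ -1)
    rcases lt_or_gt_of_ne (abs_pos.1 hl0) with h | h
    · have hl1 : 0 ≤ l₁ := by
        by_contra hc; push Not at hc; nlinarith [mul_pos_of_neg_of_neg h hc]
      have := le_abs_self (s * l₀ + t * l₁)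
      rw [abs_of_neg h] at hlt
      nlinarith [mul_nonneg (by linarith : (0:ℝ) ≤ t) hl1]
    · have hl1 : l₁ ≤ 0 := by
        by_contra hc; push Not at hc; nlinarith [mul_pos h hc]
      have := neg_abs_le (s * l₀ + t * l₁)
      rw [abs_of_pos h] at hlt
      nlinarith [mul_nonneg (by linarith : (0:ℝ) ≤ t) (neg_nonneg.2 hl1)]

/-- Two-sided sequences are determined by a three-term recurrence and two initial values. -/
theorem exists_recurrence (a : ℤ → ℕ) (x y : ℤ) :
    ∃ v : ℤ → ℤ, v 0 = x ∧ v (-1) = y ∧ ∀ n, v (n + 1) = a n * v n + v (n - 1) := by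
  let F : ℕ → ℤ × ℤ := fun k => Nat.rec (x, y) (fun k w => (a k * w.1 + w.2, w.1)) k
  let G : ℕ → ℤ × ℤ := fun k => Nat.rec (x, y)
    (fun k w => (w.2, w.1 - a (-(k + 1 : ℤ)) * w.2)) k
  let st : ℤ → ℤ × ℤ := fun n => match n with
    | Int.ofNat k => F k
    | Int.negSucc k => G (k + 1)
  have hst : ∀ n, st (n + 1) = (a n * (st n).1 + (st n).2, (st n).1) := by
    intro n
    rcases n with k | k
    · rfl
    · have hG : G k = (a (Int.negSucc k) * (G (k + 1)).1 + (G (k + 1)).2, (G (k + 1)).1) := by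
        have e : Int.negSucc k = -(k + 1 : ℤ) := by omega
        rw [e]
        ext <;> simp [G]
      have e : st (Int.negSucc k + 1) = G k := by
        rcases k with _ | k
        · rfl
        · rw [show Int.negSucc (k + 1) + 1 = Int.negSucc k by omega]
      rw [e]; exact hG
  have h2 : ∀ n, (st n).2 = (st (n - 1)).1 := fun n => by
    have := congrArg Prod.snd (hst (n - 1))
    simpa using this
  refine ⟨fun n => (st n).1, rfl, ?_, fun n => ?_⟩
  · have := h2 0
    simp only [zero_sub] at this
    exact this.symm
  · simp only [hst n, ← h2]

theorem IsChain.chainValue_pos {a : ℤ → ℕ} {X Z : ℤ → ℝ} {S : Set ℤ} (h : IsChain a X Z S) {n : ℤ}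
    (hn : n ∈ S) : 0 < chainValue X Z n := by
  have := h.one_le_right hn
  have := h.left_pos n hn
  unfold chainValue
  positivity

/-- The chain of lattice vectors that belongs to a two-sided chain of complete quotients: `l` and
`m` are the values of the linear forms `s - X 0 t` and `s + t / Z (-1)` along it. -/
theorem IsChain.exists_lattice {a : ℤ → ℕ} {X Z : ℤ → ℝ} (h : IsChain a X Z Set.univ) :
    ∃ (p q : ℤ → ℤ) (l m : ℤ → ℝ), (∀ n, l n = p n - X 0 * q n) ∧
      (∀ n, m n = p n + q n / Z (-1)) ∧ l 0 = 1 ∧ (∀ n, 0 < m n) ∧ (∀ n, l n ≠ 0) ∧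
      (∀ n, l (n - 1) = -X n * l n) ∧
      (∀ n, |l n| * m n = chainValue X Z 0 / chainValue X Z n) ∧
      (∀ n, |p n * q (n - 1) - p (n - 1) * q n| = 1) := by
  obtain ⟨p, hp0, hp1, hp⟩ := exists_recurrence a 1 0
  obtain ⟨q, hq0, hq1, hq⟩ := exists_recurrence a 0 1
  have hXpos : ∀ n, 0 < X n := fun n => by simpa using h.right_pos (n - 1) trivial
  have hZpos : ∀ n, 0 < Z n := fun n => by simpa using h.left_pos (n + 1) trivial
  have hz := hZpos (-1)
  obtain ⟨l, hl⟩ : ∃ l : ℤ → ℝ, ∀ n, l n = p n - X 0 * q n := ⟨_, fun _ => rfl⟩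
  obtain ⟨m, hm⟩ : ∃ m : ℤ → ℝ, ∀ n, m n = p n + q n / Z (-1) := ⟨_, fun _ => rfl⟩
  have hlrec : ∀ n, l (n + 1) = a n * l n + l (n - 1) := fun n => by
    simp only [hl, hp n, hq n]; push_cast; ring
  have hmrec : ∀ n, m (n + 1) = a n * m n + m (n - 1) := fun n => by
    simp only [hm, hp n, hq n]; push_cast; ring
  have hl0 : l 0 = 1 := by rw [hl, hp0, hq0]; simp
  have hm0 : m 0 = 1 := by rw [hm, hp0, hq0]; simp
  have hlX : ∀ n, l (n - 1) = -X n * l n := by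
    intro n
    induction n using Int.induction_on with
    | zero => rw [zero_sub, hl0, hl, hp1, hq1]; push_cast; ring
    | succ k ih =>
      have e := hlrec k
      have eX := h.right_eq k trivial
      have := hXpos (k + 1)
      rw [ih, eX] at e
      rw [show (k : ℤ) + 1 - 1 = k by ring, e]
      field_simp; ring
    | pred k ih =>
      have e := hlrec (-k - 1)
      have eX := h.right_eq (-k - 1) trivial
      have := hXpos (-k)
      rw [show -(k : ℤ) - 1 + 1 = -k by ring] at e eX
      rw [eX, show l (-k - 1 - 1) = l (-k) - a (-k - 1) * l (-k - 1) by linarith, ih]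
      field_simp; ring
  have hmZ : ∀ n, m n = Z (n - 1) * m (n - 1) := by
    intro n
    induction n using Int.induction_on with
    | zero => rw [zero_sub, hm0, hm, hp1, hq1]; push_cast; field_simp; simp
    | succ k ih =>
      have e := hmrec k
      have eZ := h.left_eq k trivial
      have := hZpos (k - 1)
      rw [show (k : ℤ) + 1 - 1 = k by ring, e, eZ, ih]
      field_simp
    | pred k ih =>
      have e := hmrec (-k - 1)
      have eZ := h.left_eq (-k - 1) trivial
      have := hZpos (-k - 1 - 1)
      rw [show -(k : ℤ) - 1 + 1 = -k by ring, ih, eZ] at e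
      have e2 : m (-k - 1 - 1) = 1 / Z (-k - 1 - 1) * m (-k - 1) := by linarith
      rw [e2]; field_simp
  have hmpos : ∀ n, 0 < m n := by
    intro n
    induction n using Int.induction_on with
    | zero => rw [hm0]; norm_num
    | succ k ih =>
      rw [hmZ, show (k : ℤ) + 1 - 1 = k by ring]
      exact mul_pos (hZpos _) ih
    | pred k ih => rw [hmZ] at ih; exact pos_of_mul_pos_right ih (hZpos _).le
  have hlne : ∀ n, l n ≠ 0 := by
    intro n
    induction n using Int.induction_on with
    | zero => rw [hl0]; norm_num
    | succ k ih =>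
      have := hlX (k + 1)
      rw [show (k : ℤ) + 1 - 1 = k by ring] at this
      intro h0
      rw [h0, mul_zero] at this
      exact ih this
    | pred k ih => rw [hlX]; exact mul_ne_zero (neg_ne_zero.2 (hXpos _).ne') ih
  -- Both sides equal, up to sign, determinants of the two linear forms on consecutive lattice
  -- vectors: the left one is |l (n - 1)| m n + |l n| m (n - 1).
  have hconst : ∀ n, |l n| * m n * chainValue X Z n = |l (n - 1)| * m (n - 1)
      * chainValue X Z (n - 1) := by
    intro n
    have h1 := hXpos n
    have h2 := hZpos (n - 1)
    have h3 := hZpos (n - 1 - 1)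
    rw [hlX n, abs_mul, abs_neg, abs_of_pos h1, hmZ n, h.chainValue_eq (n := n - 1) trivial,
      show n - 1 + 1 = n by ring]
    unfold chainValue
    have := h.left_eq (n - 1) trivial
    have e : (a (n - 1) : ℝ) = Z (n - 1) - 1 / Z (n - 1 - 1) := by linarith
    rw [e]; field_simp; ring
  have hval : ∀ n, |l n| * m n * chainValue X Z n = chainValue X Z 0 := by
    intro n
    induction n using Int.induction_on with
    | zero => rw [hl0, hm0]; simp
    | succ k ih => rw [hconst, show (k : ℤ) + 1 - 1 = k by ring, ih]
    | pred k ih => rw [← hconst, ih]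
  have hdet : ∀ n, |p n * q (n - 1) - p (n - 1) * q n| = 1 := by
    have step : ∀ n, |p (n + 1) * q n - p n * q (n + 1)| = |p n * q (n - 1) - p (n - 1) * q n| := by
      intro n
      rw [hp, hq, ← abs_neg]; congr 1; ring
    intro n
    induction n using Int.induction_on with
    | zero => rw [zero_sub, hp0, hp1, hq0, hq1]; norm_num
    | succ k ih => rw [show (k : ℤ) + 1 - 1 = k by ring, step, ih]
    | pred k ih =>
      have := step (-k - 1)
      rw [show -(k : ℤ) - 1 + 1 = -k by ring] at this
      rw [← this, ih]
  refine ⟨p, q, l, m, hl, hm, hl0, hmpos, hlne, hlX, fun n => ?_, hdet⟩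
  rw [eq_div_iff (h.chainValue_pos trivial).ne', hval]

/-- Every value of the chain comes from a value of the form. -/
theorem IsChain.exists_form_eq {a : ℤ → ℕ} {X Z : ℤ → ℝ} (h : IsChain a X Z Set.univ) (n : ℤ) :
    ∃ s t : ℤ, ¬(s = 0 ∧ t = 0) ∧
      |(s - X 0 * t) * (s + t / Z (-1))| = chainValue X Z 0 / chainValue X Z n := by
  obtain ⟨p, q, l, m, hl, hm, -, hmpos, hlne, -, hval, -⟩ := h.exists_lattice
  refine ⟨p n, q n, ?_, ?_⟩
  · rintro ⟨h1, h2⟩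
    exact hlne n (by rw [hl, h1, h2]; simp)
  · rw [← hl, ← hm, abs_mul, abs_of_pos (hmpos n), hval]

/-- Every value of the form is at least one of those that come from the chain. -/
theorem IsChain.exists_le_form {a : ℤ → ℕ} {X Z : ℤ → ℝ} (h : IsChain a X Z Set.univ) {s t : ℤ}
    (hne : ¬(s = 0 ∧ t = 0)) :
    ∃ n, chainValue X Z 0 / chainValue X Z n ≤ |(s - X 0 * t) * (s + t / Z (-1))| := by
  obtain ⟨p, q, l, m, hl, hm, hl0, hmpos, hlne, hlX, hval, hdet⟩ := h.exists_lattice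
  have hX1 : ∀ n, 1 ≤ X n := fun n => h.one_le_right trivial
  have hX2 : ∀ n, 2 ≤ X n * X (n + 1) := fun n => by
    have h1 := hX1 (n + 1)
    have h2 : (1 : ℝ) ≤ a n := by exact_mod_cast h.one_le n trivial
    rw [h.right_eq n trivial, add_mul, one_div, inv_mul_cancel₀ (by linarith)]
    nlinarith
  have habs : ∀ n, |l (n - 1)| = X n * |l n| := fun n => by
    rw [hlX, abs_mul, abs_neg, abs_of_pos (by linarith [hX1 n])]
  have hanti : ∀ n, |l n| ≤ |l (n - 1)| := fun n => by
    rw [habs]; nlinarith [hX1 n, abs_nonneg (l n)]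
  have hantitone : Antitone fun n => |l n| := antitone_int_of_succ_le fun n => by
    have := hanti (n + 1)
    rwa [show n + 1 - 1 = n by ring] at this
  have htwo : ∀ n, 2 * |l n| ≤ |l (n - 2)| := fun n => by
    have e1 := habs n
    have e2 := habs (n - 1)
    have e3 := hX2 (n - 1)
    rw [show n - 1 + 1 = n by ring] at e3
    rw [show n - 2 = n - 1 - 1 by ring, e2, e1]
    nlinarith [abs_nonneg (l n)]
  have hup : ∀ k : ℕ, (2 : ℝ) ^ k ≤ |l (-(2 * k))| := by
    intro k
    induction k with
    | zero => simp [hl0]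
    | succ k ih =>
      have := htwo (-(2 * k))
      rw [show -(2 * (((k + 1 : ℕ)) : ℤ)) = -(2 * k) - 2 by push_cast; ring, pow_succ]
      linarith
  have hdown : ∀ k : ℕ, |l (2 * k)| ≤ (1 / 2) ^ k := by
    intro k
    induction k with
    | zero => simp [hl0]
    | succ k ih =>
      have := htwo (2 * k + 2)
      rw [show (2 * (k : ℤ) + 2 - 2) = 2 * k by ring] at this
      rw [show (2 * (((k + 1 : ℕ)) : ℤ)) = 2 * k + 2 by push_cast; ring, pow_succ]
      linarith
  have hsmall : ∀ ε : ℝ, 0 < ε → ∃ N : ℤ, ∀ n, N ≤ n → |l n| < ε := fun ε hε => by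
    obtain ⟨k, hk⟩ := exists_pow_lt_of_lt_one hε (by norm_num : (1 / 2 : ℝ) < 1)
    exact ⟨2 * k, fun n hn => (hantitone hn).trans_lt ((hdown k).trans_lt hk)⟩
  set L := (s : ℝ) - X 0 * t with hL
  -- Otherwise t * l N = t * p N - s * q N would be a nonzero integer of absolute value below 1 for
  -- large N.
  have hL0 : L ≠ 0 := by
    intro h0
    have ht : t ≠ 0 := by
      rintro rfl
      apply hne
      refine ⟨?_, rfl⟩
      simpa [hL] using h0
    have ht1 : (0 : ℝ) < |(t : ℝ)| := by positivity
    obtain ⟨N, hN⟩ := hsmall (1 / |(t : ℝ)|) (by positivity)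
    have h1 := hN N le_rfl
    have h2 : (t : ℝ) * l N = ((t * p N - s * q N : ℤ) : ℝ) := by
      rw [hl]; push_cast
      have : (s : ℝ) = X 0 * t := by linarith
      rw [this]; ring
    have h3 : (t * p N - s * q N : ℤ) ≠ 0 := fun h => by
      rw [h, Int.cast_zero] at h2
      rcases mul_eq_zero.1 h2 with h | h
      · exact ht (by exact_mod_cast h)
      · exact hlne N h
    have h4 : (1 : ℝ) ≤ |(t : ℝ) * l N| := by rw [h2]; exact_mod_cast Int.one_le_abs h3
    rw [abs_mul] at h4
    rw [lt_div_iff₀ ht1] at h1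
    linarith
  -- The last index at which the first form exceeds |L|: then |L| ≥ |l (n + 1)|, and
  -- `best_approximation` in the basis at n, n + 1 bounds the second form below by m (n + 1).
  obtain ⟨n, hn, hmax⟩ : ∃ n, |L| < |l n| ∧ ∀ k, |L| < |l k| → k ≤ n := by
    obtain ⟨N, hN⟩ := hsmall |L| (abs_pos.2 hL0)
    refine Int.exists_greatest_of_bdd ⟨N, fun k hk => ?_⟩ ?_
    · by_contra hc
      push Not at hc
      exact (hN k hc.le).not_ge hk.le
    · obtain ⟨k, hk⟩ := pow_unbounded_of_one_lt |L| (by norm_num : (1 : ℝ) < 2)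
      exact ⟨_, hk.trans_le (hup k)⟩
  have hn1 : |l (n + 1)| ≤ |L| := by
    by_contra hc
    push Not at hc
    have := hmax _ hc
    omega
  -- coordinates of `(s, t)` in the basis of the two vectors at `n` and `n + 1`
  have hdn := hdet (n + 1)
  rw [show n + 1 - 1 = n by ring] at hdn
  obtain ⟨c, d, hs, ht⟩ : ∃ c d : ℤ, s = c * p n + d * p (n + 1) ∧ t = c * q n + d * q (n + 1) := by
    set D := p (n + 1) * q n - p n * q (n + 1) with hD
    have hDD : D * D = 1 := by rw [← abs_mul_abs_self, hdn]; norm_num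
    refine ⟨D * (p (n + 1) * t - q (n + 1) * s), D * (q n * s - p n * t), ?_, ?_⟩
    · linear_combination (-s) * hDD + s * D * hD
    · linear_combination (-t) * hDD + t * D * hD
  refine ⟨n + 1, ?_⟩
  have hLc : L = c * l n + d * l (n + 1) := by
    rw [hL, hl, hl, hs, ht]; push_cast; ring
  have hMc : (s : ℝ) + t / Z (-1) = c * m n + d * m (n + 1) := by
    rw [hm, hm, hs, ht]; push_cast; ring
  have hsign : l n * l (n + 1) ≤ 0 := by
    have := hlX (n + 1)
    rw [show n + 1 - 1 = n by ring] at this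
    rw [this]
    nlinarith [mul_self_nonneg (l (n + 1)), hX1 (n + 1)]
  have hbest := best_approximation (s := c) (t := d) hsign (hmpos n).le (hmpos (n + 1)).le (by
    rintro ⟨rfl, rfl⟩
    exact hne ⟨by rw [hs]; ring, by rw [ht]; ring⟩) (by rw [← hLc]; exact hn)
  rw [← hval, abs_mul, hMc]
  exact mul_le_mul hn1 hbest (hmpos _).le (abs_nonneg _)

/-! ### The Markov spectrum -/

/-- The form (s - X 0 t)(s + t / Z (-1)) / U, with U the value at 0, has discriminant 1 and takes
the value 1/U at (1, 0). Maximality of U and `IsChain.exists_le_form` show that it takes no smaller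
absolute value. -/
theorem IsChain.chainValue_mem_markovSpectrum {a : ℤ → ℕ} {X Z : ℤ → ℝ}
    (h : IsChain a X Z Set.univ) (hle : ∀ n, chainValue X Z n ≤ chainValue X Z 0) :
    chainValue X Z 0 ∈ markovSpectrum := by
  obtain ⟨U, hU⟩ : ∃ U, U = chainValue X Z 0 := ⟨_, rfl⟩
  have hU' : U = X 0 + 1 / Z (-1) := by rw [hU, chainValue, zero_sub]
  have hUpos : 0 < U := hU ▸ h.chainValue_pos trivial
  have hz : 0 < Z (-1) := by simpa using h.left_pos 0 trivial
  rw [← hU] at hle ⊢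
  have hform : ∀ s t : ℝ, 1 / U * s ^ 2 + (1 / Z (-1) - X 0) / U * s * t
      + -(X 0 / Z (-1)) / U * t ^ 2 = (s - X 0 * t) * (s + t / Z (-1)) / U := by
    intro s t; field_simp; ring
  have hinf : formInf (1 / U) ((1 / Z (-1) - X 0) / U) (-(X 0 / Z (-1)) / U) = 1 / U := by
    unfold formInf
    have : Nonempty {v : ℤ × ℤ // v ≠ (0, 0)} := ⟨⟨(1, 0), by simp⟩⟩
    refine le_antisymm ?_ (le_ciInf ?_)
    · refine (ciInf_le ⟨0, ?_⟩ ⟨(1, 0), by simp⟩).trans ?_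
      · rintro _ ⟨v, rfl⟩; exact abs_nonneg _
      · simp [abs_of_pos hUpos]
    · rintro ⟨⟨s, t⟩, hst⟩
      obtain ⟨n, hn⟩ := h.exists_le_form (s := s) (t := t) (by simpa [Prod.ext_iff] using hst)
      simp only
      rw [hform, abs_div, abs_of_pos hUpos]
      gcongr
      refine le_trans ?_ hn
      rw [le_div_iff₀ (h.chainValue_pos trivial), one_mul, ← hU]
      exact hle n
  refine ⟨_, _, _, ?_, by rw [hinf]; positivity, by rw [hinf, one_div_one_div]⟩
  have hne : X 0 + 1 / Z (-1) ≠ 0 := hU' ▸ hUpos.ne'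
  have e : ((1 / Z (-1) - X 0) / U) ^ 2 - 4 * (1 / U) * (-(X 0 / Z (-1)) / U)
      = (X 0 + 1 / Z (-1)) ^ 2 / U ^ 2 := by field_simp; ring
  rw [e, hU', div_self (pow_ne_zero 2 hne)]

theorem upsilon_mem_markovSpectrum : upsilon ∈ markovSpectrum := by
  rw [upsilon_eq]
  exact (isChain_quotients one_le_seqUpsilon).chainValue_mem_markovSpectrum fun n =>
    (chainValue_seqUpsilon_le n).trans_eq upsilon_eq

/-! ### From quadratic forms to chains: the upper bound in the Markov spectrum. -/

/-- The complete quotients of a real number. -/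
def gaussSeq (x : ℝ) : ℕ → ℝ
  | 0 => x
  | n + 1 => (Int.fract (gaussSeq x n))⁻¹

theorem gaussSeq_irrational {x : ℝ} (hx : Irrational x) (n : ℕ) : Irrational (gaussSeq x n) := by
  induction n with
  | zero => exact hx
  | succ n ih => exact (ih.sub_intCast _).inv

theorem fract_pos_of_irrational {x : ℝ} (hx : Irrational x) : 0 < Int.fract x := by
  refine (Int.fract_nonneg x).lt_of_ne fun h => ?_
  exact hx ⟨⌊x⌋, by rw [Rat.cast_intCast]; linarith [Int.floor_add_fract x]⟩

theorem one_lt_gaussSeq {x : ℝ} (hx : Irrational x) (n : ℕ) : 1 < gaussSeq x (n + 1) :=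
  (one_lt_inv₀ (fract_pos_of_irrational (gaussSeq_irrational hx n))).2 (Int.fract_lt_one _)

theorem gaussSeq_eq (x : ℝ) (n : ℕ) :
    gaussSeq x n = ⌊gaussSeq x n⌋ + 1 / gaussSeq x (n + 1) := by
  rw [gaussSeq, one_div, inv_inv, Int.floor_add_fract]

theorem exists_cfValue_eq {x : ℝ} (hx : Irrational x) (h1 : 1 < x) :
    ∃ c : ℕ → ℕ, (∀ k, 1 ≤ c k) ∧ cfValue c = x := by
  have hpos : ∀ n, 1 < gaussSeq x n := fun n => by
    cases n with
    | zero => exact h1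
    | succ n => exact one_lt_gaussSeq hx n
  have hfl : ∀ n, 1 ≤ ⌊gaussSeq x n⌋ := fun n => Int.le_floor.2 (by exact_mod_cast (hpos n).le)
  have hc : ∀ k, 1 ≤ ⌊gaussSeq x k⌋.toNat := fun k => by have := hfl k; omega
  refine ⟨fun k => ⌊gaussSeq x k⌋.toNat, hc, cfValue_eq_of_eq hc (x := gaussSeq x) (fun n => ?_)
    fun n => zero_lt_one.trans (hpos n)⟩
  have : ((⌊gaussSeq x n⌋.toNat : ℕ) : ℝ) = (⌊gaussSeq x n⌋ : ℝ) := by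
    have := hfl n
    exact_mod_cast Int.toNat_of_nonneg (by omega)
  rw [this, ← gaussSeq_eq]

theorem exists_chain {x z : ℝ} (hx : Irrational x) (hx1 : 1 < x) (hz : Irrational z) (hz1 : 1 < z) :
    ∃ (a : ℤ → ℕ) (X Z : ℤ → ℝ), IsChain a X Z Set.univ ∧ X 0 = x ∧ Z (-1) = z := by
  obtain ⟨c, hc, rfl⟩ := exists_cfValue_eq hx hx1
  obtain ⟨d, hd, rfl⟩ := exists_cfValue_eq hz hz1
  refine ⟨fun n => if 0 ≤ n then c n.toNat else d (-1 - n).toNat, _, _,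
    isChain_quotients fun n => ?_, ?_, ?_⟩
  · split_ifs
    exacts [hc _, hd _]
  · unfold rightQuotient; congr 1; funext k; simp
  · unfold leftQuotient; congr 1; funext k
    beta_reduce
    rw [if_neg (by omega)]; congr 1; omega

/-- The roots α, β of the form give a chain with value 1/A at 0. Every other value of the chain is
the reciprocal of a value of the form, hence at most 1/μ, so `IsChain.chainValue_le` applies. -/
theorem one_div_le_upsilon_of_reduced {A B C μ : ℝ} (hdisc : B ^ 2 - 4 * A * C = 1) (hA : 0 < A)
    (hA2 : 2 < 1 / A) (hμ : 0 < μ)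
    (hform : ∀ s t : ℤ, ¬(s = 0 ∧ t = 0) → μ ≤ |A * (s : ℝ) ^ 2 + B * s * t + C * (t : ℝ) ^ 2|)
    (hlt : 1 / μ < upperLevel) : 1 / A ≤ upsilon := by
  -- This translation puts β in [-1, 0); since α - β = 1/A > 2, it follows that α > 1.
  set k : ℤ := ⌊(-B - 1) / (2 * A)⌋ + 1 with hk
  set β := (-B - 1) / (2 * A) - k with hβ
  set α := (-B + 1) / (2 * A) - k with hα
  have hαβ : α - β = 1 / A := by rw [hα, hβ]; field_simp; ring
  have hβ0 : β < 0 := by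
    rw [hβ, hk]; push_cast; linarith [Int.lt_floor_add_one ((-B - 1) / (2 * A))]
  have hβ1 : -1 ≤ β := by
    rw [hβ, hk]; push_cast; linarith [Int.floor_le ((-B - 1) / (2 * A))]
  have hfac : ∀ s t : ℝ, A * (s + k * t) ^ 2 + B * (s + k * t) * t + C * t ^ 2
      = A * ((s - α * t) * (s - β * t)) := by
    intro s t
    have hC : C = (B ^ 2 - 1) / (4 * A) := by field_simp; linarith
    rw [hC, hα, hβ]; field_simp; ring
  have hprod : ∀ s t : ℤ, ¬(s = 0 ∧ t = 0) → μ ≤ A * |((s : ℝ) - α * t) * (s - β * t)| := by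
    intro s t hst
    have := hform (s + k * t) t (by
      rintro ⟨h1, rfl⟩
      exact hst ⟨by simpa using h1, rfl⟩)
    push_cast at this
    rwa [hfac, abs_mul, abs_of_pos hA] at this
  -- A rational root would make the form vanish at a nonzero integer vector, against μ > 0.
  have hirr : ∀ γ : ℝ, (γ = α ∨ γ = β) → Irrational γ := by
    rintro γ hγ ⟨r, rfl⟩
    have := hprod r.num r.den (by
      rintro ⟨-, h⟩
      exact r.den_ne_zero (by exact_mod_cast h))
    have hr : (r.num : ℝ) - r * r.den = 0 := by
      have : (r : ℝ) * r.den = r.num := by exact_mod_cast Rat.mul_den_eq_num r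
      linarith
    rw [Int.cast_natCast] at this
    rcases hγ with h | h <;> rw [← h, hr] at this <;> simp at this <;> linarith
  have hαi := hirr α (Or.inl rfl)
  have hβi := hirr β (Or.inr rfl)
  have hβ1' : -1 < β := hβ1.lt_of_ne fun h => hβi ⟨-1, by rw [← h]; norm_num⟩
  have hz1 : 1 < (-β)⁻¹ := (one_lt_inv₀ (by linarith)).2 (by linarith)
  obtain ⟨a, X, Z, h, hX0, hZ1⟩ := exists_chain hαi (by linarith) hβi.neg.inv hz1
  have hval0 : chainValue X Z 0 = 1 / A := by
    rw [chainValue, zero_sub, hX0, hZ1, ← hαβ, one_div, inv_inv]; ring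
  rw [← hval0]
  refine h.chainValue_le fun n => ?_
  obtain ⟨s, t, hst, hF⟩ := h.exists_form_eq n
  have hn := h.chainValue_pos (n := n) trivial
  have := hprod s t hst
  rw [hX0, hZ1, div_inv_eq_mul, hval0] at hF
  rw [show (s : ℝ) - β * t = s + t * -β by ring, hF] at this
  refine lt_of_le_of_lt ?_ hlt
  rw [le_div_iff₀ hμ]
  calc chainValue X Z n * μ ≤ chainValue X Z n * (A * (1 / A / chainValue X Z n)) := by gcongr
    _ = 1 := by field_simp

theorem le_upsilon_of_mem_markovSpectrum {m : ℝ} (hm : m ∈ markovSpectrum) (hlt : m < j₁) :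
    m ≤ upsilon := by
  obtain ⟨a, b, c, hdisc, hpos, rfl⟩ := hm
  set μ := formInf a b c with hμ
  by_contra hc
  push Not at hc
  have hU : 2 < upsilon := lt_of_lt_of_le (by norm_num) le_upsilon
  have hμlt : μ < 1 / upsilon := by
    rw [lt_div_iff₀ (by linarith)]
    rw [lt_div_iff₀ hpos] at hc
    linarith
  have : Nonempty {v : ℤ × ℤ // v ≠ (0, 0)} := ⟨⟨(1, 0), by simp⟩⟩
  have hle : ∀ s t : ℤ, ¬(s = 0 ∧ t = 0) →
      μ ≤ |a * (s : ℝ) ^ 2 + b * s * t + c * (t : ℝ) ^ 2| := fun s t hst => by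
    refine ciInf_le ⟨0, ?_⟩ (⟨(s, t), by simpa [Prod.ext_iff] using hst⟩ :
      {v : ℤ × ℤ // v ≠ (0, 0)})
    rintro _ ⟨v, rfl⟩; exact abs_nonneg _
  -- The infimum may not be attained. A vector with form value below 1/Υ is enough, because
  -- `IsChain.chainValue_le` does not ask position 0 to carry the largest value.
  obtain ⟨⟨⟨x, y⟩, hxy⟩, hv⟩ := exists_lt_of_ciInf_lt (hμ ▸ hμlt)
  simp only at hv
  have hxy' : ¬(x = 0 ∧ y = 0) := by simpa [Prod.ext_iff] using hxy
  have hg : 0 < Int.gcd x y := Int.gcd_pos_iff.2 (by tauto)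
  obtain ⟨x', y', hcop, hx, hy⟩ := Int.exists_gcd_one hg
  set g : ℤ := (Int.gcd x y : ℤ) with hgdef
  have hg1 : (1 : ℝ) ≤ g := by
    have : (1 : ℤ) ≤ g := by rw [hgdef]; exact_mod_cast hg
    exact_mod_cast this
  obtain ⟨u, w, huw⟩ := Int.isCoprime_iff_gcd_eq_one.2 hcop
  -- the basis `(x', y'), (-w, u)`
  set A := a * (x' : ℝ) ^ 2 + b * x' * y' + c * (y' : ℝ) ^ 2 with hA
  set B := -(2 * a * x' * w) + b * (x' * u - y' * w) + 2 * c * y' * u with hB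
  set C := a * (w : ℝ) ^ 2 - b * w * u + c * (u : ℝ) ^ 2 with hC
  have hdet : (u : ℝ) * x' + w * y' = 1 := by exact_mod_cast huw
  have hAv : |A| < 1 / upsilon := by
    refine lt_of_le_of_lt ?_ hv
    have e : a * (x : ℝ) ^ 2 + b * x * y + c * (y : ℝ) ^ 2 = (g : ℝ) ^ 2 * A := by
      have ex : (x : ℝ) = x' * g := by exact_mod_cast hx
      have ey : (y : ℝ) = y' * g := by exact_mod_cast hy
      rw [ex, ey, hA]; ring
    rw [e, abs_mul, abs_of_nonneg (sq_nonneg (g : ℝ))]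
    exact le_mul_of_one_le_left (abs_nonneg A) (one_le_pow₀ hg1)
  have hdisc' : B ^ 2 - 4 * A * C = 1 := by
    have : B ^ 2 - 4 * A * C = (b ^ 2 - 4 * a * c) * (u * x' + w * y') ^ 2 := by
      rw [hA, hB, hC]; ring
    rw [this, hdisc, hdet]; norm_num
  have hform : ∀ s t : ℤ, ¬(s = 0 ∧ t = 0) →
      μ ≤ |A * (s : ℝ) ^ 2 + B * s * t + C * (t : ℝ) ^ 2| := fun s t hst => by
    have := hle (s * x' - t * w) (s * y' + t * u) (by
      rintro ⟨h1, h2⟩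
      apply hst
      constructor
      · linear_combination u * h1 + w * h2 - s * huw
      · linear_combination x' * h2 - y' * h1 - t * huw)
    refine this.trans_eq ?_
    congr 1
    push_cast
    rw [hA, hB, hC]; ring
  have hApos : 0 < |A| := by
    have := hform 1 0 (by simp)
    simp at this
    linarith
  have hinv : upsilon < 1 / |A| := by
    rw [lt_div_iff₀ hApos]; rw [lt_div_iff₀ (by linarith)] at hAv; linarith
  have hμT : 1 / μ < upperLevel := hlt.trans_le j₁_le
  refine hinv.not_ge ?_
  rcases lt_or_gt_of_ne (abs_pos.1 hApos) with h | h
  · rw [abs_of_neg h] at hinv ⊢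
    refine one_div_le_upsilon_of_reduced (B := -B) (C := -C) (by linarith) (by linarith)
      (by linarith) hpos (fun s t hst => ?_) hμT
    rw [← abs_neg]
    convert hform s t hst using 2
    ring
  · rw [abs_of_pos h] at hinv ⊢
    exact one_div_le_upsilon_of_reduced hdisc' h (by linarith) hpos hform hμT

/-! ### The Lagrange spectrum -/

section Recurrence

variable {a : ℤ → ℕ} {X Z : ℤ → ℝ} {S : Set ℤ}

theorem IsChain.false_of_hasWord (h : IsChain a X Z S)
    (hlt : ∀ n ∈ S, chainValue X Z n < upperLevel) {n₁ n₂ : ℤ} (hn : n₁ + 100 ≤ n₂)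
    (hS : ∀ j, n₁ - 50 ≤ j → j ≤ n₂ + 50 → j ∈ S) (h₁ : ReadsRight a (n₁ + 1) longRightPattern)
    (h₂ : HasWord a n₂) : False := by
  simp only [longRightPattern, ReadsRight, and_true, add_assoc] at h₁
  norm_num at h₁
  -- The period contains a single 1, so the 1 at n₁ + 11 fixes the phase; two places later the
  -- period has a 3, whereas the long word has a 2.
  obtain ⟨-, -, -, -, -, -, -, -, -, -, ha, -, hb, -⟩ := h₁
  obtain ⟨k, r, hr, hk⟩ : ∃ k r : ℕ, r < 7 ∧ n₂ - 7 * k - r = n₁ + 11 :=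
    ⟨((n₂ - (n₁ + 11)) / 7).toNat, ((n₂ - (n₁ + 11)) % 7).toNat, by omega, by omega⟩
  have hw := h.hasWord_sub hlt h₂ k (fun j h1 h2 => hS j (by omega) (by omega))
  have h3 := hw.eq_seqUpsilon hr
  rw [hk, ha] at h3
  have hr3 : r = 3 := by
    interval_cases r <;> revert h3 <;> decide
  have h4 := hw.eq_seqUpsilon (r := 1) (by norm_num)
  rw [show n₂ - 7 * (k : ℤ) - ((1 : ℕ) : ℤ) = n₁ + 13 by omega, hb] at h4
  revert h4; decide

theorem IsChain.false_of_frequently {N : ℤ} (h : IsChain a X Z (Set.Ici N))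
    (hlt : ∀ n ∈ Set.Ici N, chainValue X Z n < upperLevel)
    (hfreq : ∀ M, ∃ n, M ≤ n ∧ lowerLevel < chainValue X Z n) : False := by
  have hloc : ∀ n, N + 50 ≤ n → lowerLevel < chainValue X Z n → _ := fun n hn hgt =>
    h.local_uniqueness hlt hgt (fun j h1 _ => Set.mem_Ici.2 (by omega))
  -- One of the two orientations occurs arbitrarily far out; the second is reduced to the first by
  -- reversal, which only needs a finite window.
  by_cases hA : ∀ M, ∃ n, M ≤ n ∧ a n = 3 ∧
      ReadsLeft a (n - 1) leftPattern ∧ ReadsRight a (n + 1) longRightPattern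
  · obtain ⟨n₁, hn₁, -, -, hR⟩ := hA (N + 100)
    obtain ⟨n₂, hn₂, h3, hL', hR'⟩ := hA (n₁ + 100)
    exact h.false_of_hasWord hlt hn₂ (fun j h1 _ => Set.mem_Ici.2 (by omega)) hR
      (hasWord_of_long h3 hL' hR')
  · push Not at hA
    obtain ⟨M, hM⟩ := hA
    have hB : ∀ K, ∃ n, K ≤ n ∧ a n = 3 ∧
        ReadsRight a (n + 1) leftPattern ∧ ReadsLeft a (n - 1) longRightPattern := by
      intro K
      obtain ⟨n, hn, hgt⟩ := hfreq (max K (max M (N + 50)))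
      simp only [max_le_iff] at hn
      obtain ⟨h3, hw | hw⟩ := hloc n hn.2.2 hgt
      · exact absurd hw.2 (hM n hn.2.1 h3 hw.1)
      · exact ⟨n, hn.1, h3, hw⟩
    obtain ⟨n₁, hn₁, h3, hR, hL⟩ := hB (N + 100)
    obtain ⟨n₂, hn₂, -, -, hL'⟩ := hB (n₁ + 100)
    refine h.reverse.false_of_hasWord (n₁ := -n₂) (n₂ := -n₁)
      (fun n hn => by rw [h.chainValue_reverse hn]; exact hlt _ hn) (by omega)
      (fun j _ h2 => show N ≤ -j by omega) ?_ (hasWord_of_long (by simpa using h3) ?_ ?_)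
    · rwa [readsRight_reverse, show -(-n₂ + 1) = n₂ - 1 by ring]
    · rwa [readsLeft_reverse, show -(-n₁ - 1) = n₁ + 1 by ring]
    · rwa [readsRight_reverse, show -(-n₁ + 1) = n₁ - 1 by ring]

end Recurrence

/-! ### Convergents of an irrational number. -/

/-- The integers `v 0 = x`, `v 1 = y`, `v (n + 2) = c (n + 1) v (n + 1) + v n`. -/
def contSeq (c : ℕ → ℤ) (x y : ℤ) : ℕ → ℤ
  | 0 => x
  | 1 => y
  | n + 2 => c (n + 1) * contSeq c x y (n + 1) + contSeq c x y n

/-- The partial quotients of a real number. -/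
def gaussDigit (α : ℝ) (n : ℕ) : ℤ := ⌊gaussSeq α n⌋

/-- The index is shifted by one from the usual convention: index 0 is the formal convergent 1/0,
index 1 is ⌊α⌋/1. -/
def convNum (α : ℝ) : ℕ → ℤ := contSeq (gaussDigit α) 1 (gaussDigit α 0)

def convDen (α : ℝ) : ℕ → ℤ := contSeq (gaussDigit α) 0 1

/-- The value of the linear form `q α - p` at the `n`-th convergent. -/
def convErr (α : ℝ) (n : ℕ) : ℝ := convDen α n * α - convNum α n

section Convergents

variable {α : ℝ}

theorem one_le_gaussDigit (hα : Irrational α) (n : ℕ) : 1 ≤ gaussDigit α (n + 1) :=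
  Int.le_floor.2 (by exact_mod_cast (one_lt_gaussSeq hα n).le)

theorem one_le_convDen (hα : Irrational α) (n : ℕ) : 1 ≤ convDen α (n + 1) := by
  induction n using Nat.twoStepInduction with
  | zero => exact le_rfl
  | one =>
    have := one_le_gaussDigit hα 0
    simpa [convDen, contSeq] using this
  | more n ih1 ih2 =>
    have h1 := one_le_gaussDigit hα (n + 1)
    have e : convDen α (n + 2 + 1) = gaussDigit α (n + 1 + 1) * convDen α (n + 1 + 1)
      + convDen α (n + 1) := rfl
    rw [e]; nlinarith

theorem le_convDen (hα : Irrational α) (n : ℕ) : (n : ℤ) ≤ convDen α (n + 1) := by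
  induction n with
  | zero => exact zero_le_one
  | succ n ih =>
    obtain _ | n := n
    · exact one_le_convDen hα 1
    · have h1 := one_le_gaussDigit hα (n + 1)
      have h2 := one_le_convDen hα n
      have e : convDen α (n + 1 + 1 + 1) = gaussDigit α (n + 1 + 1) * convDen α (n + 1 + 1)
        + convDen α (n + 1) := rfl
      rw [e]; push_cast at ih ⊢; nlinarith

theorem convDen_nonneg (hα : Irrational α) (n : ℕ) : 0 ≤ convDen α n := by
  obtain _ | n := n
  · exact le_rfl
  · exact zero_le_one.trans (one_le_convDen hα n)

theorem convErr_eq (hα : Irrational α) (n : ℕ) :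
    convErr α n = -gaussSeq α (n + 1) * convErr α (n + 1) := by
  induction n with
  | zero =>
    have h := gaussSeq_eq α 0
    have h1 := one_lt_gaussSeq hα 0
    have e : α - gaussDigit α 0 = 1 / gaussSeq α 1 := by
      simp only [gaussDigit]; simp only [gaussSeq] at h ⊢; linarith
    simp only [convErr, convDen, convNum, contSeq]
    push_cast
    rw [one_mul, e]; field_simp; ring
  | succ n ih =>
    have e : convErr α (n + 2) = gaussDigit α (n + 1) * convErr α (n + 1) + convErr α n := by
      simp only [convErr, convDen, convNum, contSeq]; push_cast; ring
    have h := gaussSeq_eq α (n + 1)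
    have h1 := one_lt_gaussSeq hα (n + 1)
    rw [e, ih, h]
    simp only [gaussDigit]
    field_simp; ring

theorem convErr_ne_zero (hα : Irrational α) (n : ℕ) : convErr α n ≠ 0 := by
  induction n with
  | zero => simp [convErr, convDen, convNum, contSeq]
  | succ n ih => rw [convErr_eq hα] at ih; exact right_ne_zero_of_mul ih

theorem abs_convErr_eq (hα : Irrational α) (n : ℕ) :
    |convErr α n| = gaussSeq α (n + 1) * |convErr α (n + 1)| := by
  rw [convErr_eq hα, abs_mul, abs_neg, abs_of_pos (by linarith [one_lt_gaussSeq hα n])]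

/-- The determinant identity of consecutive convergents; absolute values can be added because the
errors alternate in sign. -/
theorem convErr_mul_add (hα : Irrational α) (n : ℕ) :
    |convErr α n| * convDen α (n + 1) + |convErr α (n + 1)| * convDen α n = 1 := by
  induction n with
  | zero => simp [convErr, convDen, convNum, contSeq]
  | succ n ih =>
    have e : convDen α (n + 2) = gaussDigit α (n + 1) * convDen α (n + 1) + convDen α n := rfl
    have h := gaussSeq_eq α (n + 1)
    have h1 := one_lt_gaussSeq hα (n + 1)
    have h2 : |convErr α n| = gaussDigit α (n + 1) * |convErr α (n + 1)| + |convErr α (n + 2)| := by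
      rw [abs_convErr_eq hα n, h, abs_convErr_eq hα (n + 1)]
      simp only [gaussDigit]
      field_simp
    rw [h2] at ih
    rw [e]; push_cast; linarith

theorem abs_convErr_le (hα : Irrational α) (n : ℕ) : |convErr α n| * n ≤ 1 := by
  have h1 := convErr_mul_add hα n
  have h2 : (n : ℝ) ≤ convDen α (n + 1) := by exact_mod_cast le_convDen hα n
  have h3 : (0 : ℝ) ≤ convDen α n := by exact_mod_cast convDen_nonneg hα n
  nlinarith [abs_nonneg (convErr α n), mul_nonneg (abs_nonneg (convErr α (n + 1))) h3]

theorem abs_convErr_le_one (hα : Irrational α) (n : ℕ) : |convErr α n| ≤ 1 := by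
  obtain _ | n := n
  · simp [convErr, convDen, convNum, contSeq]
  · have h1 := abs_convErr_le hα (n + 1)
    have : (1 : ℝ) ≤ (n + 1 : ℕ) := by exact_mod_cast Nat.le_add_left 1 n
    nlinarith [abs_nonneg (convErr α (n + 1))]

theorem convNum_mul_sub (n : ℕ) :
    |convNum α (n + 1) * convDen α n - convNum α n * convDen α (n + 1)| = 1 := by
  induction n with
  | zero => simp [convDen, convNum, contSeq]
  | succ n ih =>
    have e : convDen α (n + 1 + 1) = gaussDigit α (n + 1) * convDen α (n + 1) + convDen α n := rfl
    have e' : convNum α (n + 1 + 1) = gaussDigit α (n + 1) * convNum α (n + 1) + convNum α n := rfl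
    rw [← ih, ← abs_neg, e, e']; congr 1; ring

theorem tendsto_convDen (hα : Irrational α) : Tendsto (convDen α) atTop cofinite := by
  rw [← Nat.cofinite_eq_atTop]
  refine Tendsto.cofinite_of_finite_preimage_singleton fun k => ?_
  refine (Set.finite_Iic (k.toNat + 1)).subset fun n hn => ?_
  simp only [Set.mem_preimage, Set.mem_singleton_iff] at hn
  obtain _ | n := n
  · simp
  · have := le_convDen hα n
    simp only [Set.mem_Iic]; omega

theorem tendsto_convNum (hα : Irrational α) : Tendsto (convNum α) atTop cofinite := by
  rw [← Nat.cofinite_eq_atTop]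
  refine Tendsto.cofinite_of_finite_preimage_singleton fun k => ?_
  have hα0 : 0 < |α| := abs_pos.2 hα.ne_zero
  refine (Set.finite_Iic (⌈(|(k : ℝ)| + 1) / |α|⌉₊ + 1)).subset fun n hn => ?_
  simp only [Set.mem_preimage, Set.mem_singleton_iff] at hn
  obtain _ | n := n
  · simp
  · have h1 : (n : ℝ) ≤ convDen α (n + 1) := by exact_mod_cast le_convDen hα n
    have h2 := abs_convErr_le_one hα (n + 1)
    have h3 : (convDen α (n + 1) : ℝ) * |α| ≤ |(k : ℝ)| + 1 := by
      have h4 : (0 : ℝ) ≤ convDen α (n + 1) := by exact_mod_cast convDen_nonneg hα (n + 1)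
      rw [← abs_of_nonneg h4, ← abs_mul, ← hn]
      have e : (convDen α (n + 1) : ℝ) * α = convNum α (n + 1) + convErr α (n + 1) := by
        rw [convErr]; ring
      rw [e]
      exact (abs_add_le _ _).trans (by linarith)
    have h5 : (n : ℝ) ≤ ⌈(|(k : ℝ)| + 1) / |α|⌉₊ := by
      refine le_trans ?_ (Nat.le_ceil _)
      rw [le_div_iff₀ hα0]
      nlinarith
    have h6 : n ≤ ⌈(|(k : ℝ)| + 1) / |α|⌉₊ := by exact_mod_cast h5
    simp only [Set.mem_Iic]; omega

/-- The complete quotients of `α`, together with the quotients of consecutive denominators. -/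
theorem isChain_convergents (hα : Irrational α) :
    IsChain (fun n => (gaussDigit α n.toNat).toNat) (fun n => gaussSeq α n.toNat)
      -- The chain starts at 2, since the left quotient at n - 1 must have the nonzero denominator
      -- `convDen α (n - 1)`.
      (fun n => (convDen α (n.toNat + 1) : ℝ) / convDen α n.toNat) (Set.Ici 2) := by
  have hden : ∀ n, (0 : ℝ) < convDen α (n + 1) := fun n => by
    exact_mod_cast one_le_convDen hα n
  have hdigit : ∀ n, (((gaussDigit α (n + 1)).toNat : ℕ) : ℝ) = gaussDigit α (n + 1) := fun n => by
    have := one_le_gaussDigit hα n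
    exact_mod_cast Int.toNat_of_nonneg (by omega)
  have hn : ∀ n ∈ Set.Ici (2 : ℤ), ∃ m : ℕ, n.toNat = m + 2 ∧ (n + 1).toNat = m + 3 ∧
      (n - 1).toNat = m + 1 := fun n hn => by
    have := Set.mem_Ici.1 hn
    exact ⟨n.toNat - 2, by omega, by omega, by omega⟩
  constructor <;> intro n h <;> obtain ⟨m, h0, h1, h2⟩ := hn n h <;>
    simp only [h0, h1, h2]
  · rw [hdigit (m + 1)]; exact gaussSeq_eq α (m + 2)
  · have e : convDen α (m + 2 + 1) = gaussDigit α (m + 1 + 1) * convDen α (m + 2)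
      + convDen α (m + 1) := rfl
    have := hden m
    have := hden (m + 1)
    rw [hdigit (m + 1), e]; push_cast; field_simp
  · have := one_le_gaussDigit hα (m + 1)
    simp only [Nat.add_assoc, Nat.reduceAdd] at this
    omega
  · linarith [one_lt_gaussSeq hα (m + 2)]
  · exact div_pos (hden _) (hden _)

theorem chainValue_convergents (hα : Irrational α) {n : ℕ} (hn : 1 ≤ n) :
    chainValue (fun n => gaussSeq α n.toNat)
      (fun n => (convDen α (n.toNat + 1) : ℝ) / convDen α n.toNat) n
      = 1 / |(convDen α n : ℝ) * ((convDen α n : ℝ) * α - convNum α n)| := by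
  obtain ⟨m, rfl⟩ : ∃ m, n = m + 1 := ⟨n - 1, by omega⟩
  have h1 := convErr_mul_add hα m
  have h2 : (0 : ℝ) < convDen α (m + 1) := by exact_mod_cast one_le_convDen hα m
  have h3 := abs_pos.2 (convErr_ne_zero hα (m + 1))
  rw [abs_convErr_eq hα] at h1
  rw [← convErr, abs_mul, abs_of_pos h2]
  simp only [chainValue, Int.toNat_natCast, Nat.cast_add, Nat.cast_one, add_sub_cancel_right,
    show ((m : ℤ) + 1).toNat = m + 1 by omega, one_div, inv_div]
  rw [← one_div, eq_div_iff (by positivity)]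
  field_simp
  linarith

/-- Any sufficiently good approximation is matched by a convergent of index at least N, so the
limsup is decided by convergents: take the first index whose error is at most |qα - p| and apply
`best_approximation`. -/
theorem exists_convErr_le (hα : Irrational α) {N : ℕ} {p q : ℤ} (hq : q ≠ 0)
    (hlt : |q * α - p| < |convErr α N|) :
    ∃ n, N ≤ n ∧ |convErr α n| * convDen α n ≤ |(q : ℝ) * (q * α - p)| := by
  have hL0 : 0 < |q * α - p| := abs_pos.2 fun h0 => by
    refine hα ⟨p / q, ?_⟩
    have : (q : ℝ) ≠ 0 := by exact_mod_cast hq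
    push_cast; field_simp; linarith
  have hex : ∃ n, |convErr α (N + n)| ≤ |q * α - p| := by
    obtain ⟨k, hk⟩ := exists_nat_gt (1 / |q * α - p|)
    refine ⟨k + 1, ?_⟩
    have h1 := abs_convErr_le hα (N + (k + 1))
    rw [div_lt_iff₀ hL0] at hk
    have hk0 : (0 : ℝ) ≤ k := by positivity
    by_contra hc
    push Not at hc
    push_cast at h1
    have : (0 : ℝ) ≤ N := by positivity
    nlinarith
  classical
  obtain ⟨n, hn, hmin⟩ : ∃ n, |convErr α (N + n)| ≤ |q * α - p| ∧
      ∀ m < n, |q * α - p| < |convErr α (N + m)| :=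
    ⟨Nat.find hex, Nat.find_spec hex, fun m hm => not_le.1 (Nat.find_min hex hm)⟩
  obtain _ | n := n
  · exact absurd hlt (not_lt.2 hn)
  have hn' := hmin n (Nat.lt_succ_self n)
  refine ⟨N + (n + 1), by omega, ?_⟩
  rw [← add_assoc] at hn ⊢
  set k := N + n
  have hdn := convNum_mul_sub (α := α) k
  obtain ⟨c, d, hp, hq'⟩ : ∃ c d : ℤ, p = c * convNum α k + d * convNum α (k + 1) ∧
      q = c * convDen α k + d * convDen α (k + 1) := by
    set D := convNum α (k + 1) * convDen α k - convNum α k * convDen α (k + 1) with hD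
    have hDD : D * D = 1 := by rw [← abs_mul_abs_self, hdn]; norm_num
    refine ⟨D * (convNum α (k + 1) * q - convDen α (k + 1) * p),
      D * (convDen α k * p - convNum α k * q), ?_, ?_⟩
    · linear_combination (-p) * hDD + p * D * hD
    · linear_combination (-q) * hDD + q * D * hD
  have hL : q * α - p = c * convErr α k + d * convErr α (k + 1) := by
    rw [convErr, convErr, hp, hq']; push_cast; ring
  have hM : (q : ℝ) = c * convDen α k + d * convDen α (k + 1) := by rw [hq']; push_cast; ring
  have hd0 : ∀ n, (0 : ℝ) ≤ convDen α n := fun n => by exact_mod_cast convDen_nonneg hα n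
  have hsign : convErr α k * convErr α (k + 1) ≤ 0 := by
    rw [convErr_eq hα k]
    nlinarith [mul_self_nonneg (convErr α (k + 1)), one_lt_gaussSeq hα k]
  have hbest := best_approximation (s := c) (t := d) hsign (hd0 k) (hd0 (k + 1)) (by
    rintro ⟨rfl, rfl⟩
    exact hq (by rw [hq']; ring)) (by rw [← hL]; exact hn')
  rw [abs_mul, mul_comm, hL, hM]
  rw [hL] at hn
  exact mul_le_mul hbest hn (abs_nonneg _) (abs_nonneg _)

end Convergents

theorem upsilon_notMem_lagrangeSpectrum : upsilon ∉ lagrangeSpectrum := by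
  rintro ⟨α, hα, hlim⟩
  have hch := isChain_convergents hα
  set X : ℤ → ℝ := fun n => gaussSeq α n.toNat with hX
  set Z : ℤ → ℝ := fun n => (convDen α (n.toNat + 1) : ℝ) / convDen α n.toNat with hZ
  have hval : ∀ n : ℕ, 1 ≤ n → chainValue X Z n
      = 1 / |(convDen α n : ℝ) * ((convDen α n : ℝ) * α - convNum α n)| :=
    fun n hn => chainValue_convergents hα hn
  -- eventually the values are below the upper level
  have hev : ∀ᶠ pq : ℤ × ℤ in (cofinite : Filter ℤ) ×ˢ (cofinite : Filter ℤ),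
      1 / |(pq.2 : ℝ) * ((pq.2 : ℝ) * α - (pq.1 : ℝ))| < upperLevel := by
    have := eventually_lt_of_limsup_lt
      (hlim.trans_lt (EReal.coe_lt_coe_iff.2 upsilon_lt_upperLevel))
    filter_upwards [this] with pq h using EReal.coe_lt_coe_iff.1 h
  have hev' := ((tendsto_convNum hα).prodMk (tendsto_convDen hα)).eventually hev
  obtain ⟨N, hN⟩ := eventually_atTop.1 hev'
  -- infinitely often they are above the lower level
  have hfreq : ∀ M : ℕ, 1 ≤ M → ∃ n, M ≤ n ∧ lowerLevel < chainValue X Z n := by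
    intro M hM
    by_contra hc
    push Not at hc
    have hl0 : 0 < lowerLevel := by unfold lowerLevel; norm_num
    have herr := abs_pos.2 (convErr_ne_zero hα M)
    have hle : ∀ᶠ pq : ℤ × ℤ in (cofinite : Filter ℤ) ×ˢ (cofinite : Filter ℤ),
        ((1 / |(pq.2 : ℝ) * ((pq.2 : ℝ) * α - (pq.1 : ℝ))| : ℝ) : EReal)
          ≤ ((lowerLevel : ℝ) : EReal) := by
      set K : ℤ := ⌈1 / (lowerLevel * |convErr α M|)⌉ with hK
      have hcof : ∀ᶠ q : ℤ in cofinite, K < |q| := by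
        have : {q : ℤ | ¬ K < |q|}.Finite :=
          (Set.finite_Icc (-K) K).subset fun q hq => by
            simp only [Set.mem_ofPred_eq, not_lt, abs_le] at hq
            exact hq
        exact this
      filter_upwards [hcof.prod_inr cofinite] with ⟨p, q⟩ hq
      simp only at hq
      rw [EReal.coe_le_coe_iff]
      have hK0 : 0 ≤ K := Int.ceil_nonneg (by positivity)
      have hq0 : q ≠ 0 := abs_pos.1 (hK0.trans_lt hq)
      rcases lt_or_ge |(q : ℝ) * α - p| |convErr α M| with hlt | hge
      · obtain ⟨n, hn, hle⟩ := exists_convErr_le hα hq0 hlt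
        have h1 := hc n hn
        rw [hval n (hM.trans hn), ← convErr, abs_mul] at h1
        refine le_trans ?_ h1
        have h2 := abs_pos.2 (convErr_ne_zero hα n)
        have h3 : 1 ≤ convDen α n := by
          obtain ⟨m, rfl⟩ : ∃ m, n = m + 1 := ⟨n - 1, by omega⟩
          exact one_le_convDen hα m
        have h4 : (0 : ℝ) < convDen α n := by exact_mod_cast h3
        rw [abs_of_pos h4, mul_comm (convDen α n : ℝ)]
        exact one_div_le_one_div_of_le (by positivity) hle
      · have h1 : 1 / (lowerLevel * |convErr α M|) ≤ |(q : ℝ)| := by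
          refine (Int.le_ceil _).trans ?_
          exact_mod_cast hq.le
        have hqpos : (0 : ℝ) < |(q : ℝ)| := abs_pos.2 (by exact_mod_cast hq0)
        rw [div_le_iff₀ (by positivity)] at h1
        rw [abs_mul, div_le_iff₀ (mul_pos hqpos (herr.trans_le hge))]
        calc (1 : ℝ) ≤ |(q : ℝ)| * (lowerLevel * |convErr α M|) := h1
          _ = lowerLevel * (|(q : ℝ)| * |convErr α M|) := by ring
          _ ≤ _ := by gcongr
    have := limsup_le_of_le (h := hle)
    rw [hlim, EReal.coe_le_coe_iff] at this
    exact this.not_gt lowerLevel_lt_upsilon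
  have hsub : Set.Ici (max 2 (N : ℤ)) ⊆ Set.Ici 2 := Set.Ici_subset_Ici.2 (le_max_left _ _)
  refine (hch.mono hsub).false_of_frequently (fun n hn => ?_) (fun M => ?_)
  · have hn' := max_le_iff.1 (Set.mem_Ici.1 hn)
    obtain ⟨k, rfl⟩ := Int.eq_ofNat_of_zero_le (by omega : 0 ≤ n)
    rw [hval k (by omega)]
    exact hN k (by omega)
  · obtain ⟨n, hn, h⟩ := hfreq (M.toNat + 1) (by omega)
    exact ⟨n, by omega, h⟩

end MarkovLagrange

end

theorem mainTheorem7 :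
    IsGreatest
        ((MarkovLagrange.markovSpectrum \ MarkovLagrange.lagrangeSpectrum) ∩ MarkovLagrange.J)
        MarkovLagrange.upsilon ∧
      (3.7096998597503806 : ℝ) ≤ MarkovLagrange.upsilon ∧
      MarkovLagrange.upsilon < (3.7096998597503807 : ℝ) := by
  refine ⟨⟨⟨⟨MarkovLagrange.upsilon_mem_markovSpectrum,
    MarkovLagrange.upsilon_notMem_lagrangeSpectrum⟩, MarkovLagrange.upsilon_mem_J⟩, ?_⟩, ?_, ?_⟩
  · rintro m ⟨⟨hm, -⟩, hJ⟩
    exact MarkovLagrange.le_upsilon_of_mem_markovSpectrum hm hJ.2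
  · refine le_trans ?_ MarkovLagrange.le_upsilon
    norm_num
  · refine lt_of_le_of_lt MarkovLagrange.upsilon_le ?_
    norm_num
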